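/- Let $n\ge 0$. The planar braid group $\overline{B}_n$ is generated by $\sigma_1,\dots,\sigma_{n-1}$ with the relations $\sigma_i^2=1$ and $\sigma_i\sigma_j=\sigma_j\sigma_i$ for $|i-j|>1$; the planar pure braid group $\overline{P}_n$ is the kernel of the homomorphism $\overline{B}_n\to S_n$, $\sigma_i\mapsto\tau_i=(i\ \,i{+}1)$. A crossing type is an ordered partition $I=(I_1,I_2,I_3)$ of $\{1,\dots,n\}$ (blocks may be empty) with $|I_2|=2$; it is essential if some $x\in I_3$ is greater than all elements of $I_2$. A double crossing type is an ordered partition $J=(J_1,\dots,J_5)$ of $\{1,\dots,n\}$ with $|J_2|=|J_4|=2$; it is essential if some $x_1\in J_3$ is greater than all elements of $J_2$ and some $x_2\in J_5$ is greater than all elements of $J_4$. Put $J_{[1]}=(J_1,J_2,J_3\sqcup J_4\sqcup J_5)$ and $J_{[2]}=(J_1\sqcup J_2\sqcup J_3,J_4,J_5)$; these are essential if $J$ is. Write an arrangement of the strands as a sequence $s=(s_1,\dots,s_n)$ (a permutation of $1,\dots,n$), and let $s\tau_k$ be $s$ with $s_k$ and $s_{k+1}$ exchanged. The pair $[s,k]$,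 $1\le k<n$, has the crossing type $(\{s_1,\dots,s_{k-1}\},\{s_k,s_{k+1}\},\{s_{k+2},\dots,s_n\})$. The descending spanning tree on the arrangements has the root $(n,n-1,\dots,1)$, and the parent of any other $s$ is $s\tau_m$, where $m$ is the greatest index with $s_m<s_{m+1}$. Let $r(s)\in\overline{B}_n$ be the product of the $\sigma_m$ along the path in the tree from $s$ to the root, $t(s)=r(1,2,\dots,n)\,r(s)^{-1}$, and $b(s,k)=t(s)\,\sigma_k\,t(s\tau_k)^{-1}$. For a crossing type $I$ let $b_I=b(s,|I_1|+1)$, where $s$ lists $I_1,I_2,I_3$ one after another, each in decreasing order. Rewriting algorithm. Define words $c(s,k)$ and $w(s,k)$ in the crossing types and their inverses recursively. If $s_1>s_2>\dots>s_{k-1}$, then $c(s,k)$ is empty. Otherwise let $m<k-1$ be the greatest index with $s_m<s_{m+1}$ and put $c(s,k)=w(s,m)\,c(s\tau_m,k)$. Further, $w(s,k)=c(s,k)\,I^{\varepsilon}\,c(s,k)^{-1}$, where $I$ is the crossing type of $[s,k]$, $\varepsilon=1$ if $s_k>s_{k+1}$ and $\varepsilon=-1$ if $s_k<s_{k+1}$.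 (Words are not reduced; inverses are formal.) For an essential double crossing type $J$ let $s$ be the arrangement that lists $J_1,\dots,J_5$ one after another, each in decreasing order, and let $k=|J_1|+1$, $l=|J_1|+|J_3|+3$. Let $u_J$ and $v_J$ be the words obtained from $c(s,l)^{-1}$ and $c(s\tau_k,l)^{-1}$, respectively, by deleting all letters that are non-essential crossing types. Theorem. For every essential double crossing type $J$ on $n$ strands, the words $u_J$ and $v_J$ contain neither $J_{[1]}^{\pm1}$ nor $J_{[2]}^{\pm1}$. The group $\overline{P}_n$ has a presentation whose generators are the essential crossing types on $n$ strands, with one relation $$r_J:\qquad [\,u_J\,J_{[1]}\,v_J^{-1},\ J_{[2]}\,]=1$$ for each essential double crossing type $J$ on $n$ strands; the generator $I$ corresponds to the planar pure braid $b_I\in\overline{P}_n$. -/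

import Mathlib

namespace PlanarBraid

open Equiv
open scoped commutatorElement

/-! ### Planar braids

Strands and positions are numbered from `0`, so that `{1, …, n}` becomes `Fin n` and the generators
`σ_1, …, σ_{n-1}` are indexed by `Fin (n - 1)`. The generator with index `k` exchanges the strands in
the positions `lo k = k` and `hi k = k + 1`. -/

/-- The left one of the two positions exchanged by the `k`-th generator. -/
def lo {n : ℕ} (k : Fin (n - 1)) : Fin n := ⟨k.val, by omega⟩

/-- The right one of the two positions exchanged by the `k`-th generator. -/
def hi {n : ℕ} (k : Fin (n - 1)) : Fin n := ⟨k.val + 1, by omega⟩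

/-- The elementary transposition `τ_k = (k  k+1)`. -/
def tau {n : ℕ} (k : Fin (n - 1)) : Perm (Fin n) := swap (lo k) (hi k)

/-- The defining relators `σ_i ^ 2` and `[σ_i, σ_j]`, `|i - j| > 1`, of the planar braid group. -/
def braidRels (n : ℕ) : Set (FreeGroup (Fin (n - 1))) :=
  {r | (∃ i, r = FreeGroup.of i ^ 2) ∨
    ∃ i j : Fin (n - 1), i.val + 1 < j.val ∧ r = ⁅FreeGroup.of i, FreeGroup.of j⁆}

/-- The planar braid group (twin group) on `n` strands. -/
abbrev PlanarBraidGroup (n : ℕ) : Type := PresentedGroup (braidRels n)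

/-- The generator `σ_k` of the planar braid group. -/
def sigma {n : ℕ} (k : Fin (n - 1)) : PlanarBraidGroup n := PresentedGroup.of k

theorem tau_rels {n : ℕ} : ∀ r ∈ braidRels n, FreeGroup.lift (tau (n := n)) r = 1 := by
  rintro r (⟨i, rfl⟩ | ⟨i, j, hij, rfl⟩)
  · simp [tau, pow_two]
  · rw [map_commutatorElement, FreeGroup.lift_apply_of, FreeGroup.lift_apply_of,
      commutatorElement_eq_one_iff_commute]
    apply Perm.Disjoint.commute
    intro x
    by_cases h : x = lo i ∨ x = hi i
    · right
      refine swap_apply_of_ne_of_ne ?_ ?_ <;>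
        rcases h with rfl | rfl <;> simp only [lo, hi, ne_eq, Fin.mk.injEq] <;> omega
    · left
      exact swap_apply_of_ne_of_ne (fun e => h (Or.inl e)) (fun e => h (Or.inr e))

/-- The homomorphism of the planar braid group to the symmetric group, `σ_k ↦ τ_k`. -/
def toPerm (n : ℕ) : PlanarBraidGroup n →* Perm (Fin n) := PresentedGroup.toGroup tau_rels

/-- The planar pure braid group on `n` strands. -/
abbrev PlanarPureBraidGroup (n : ℕ) : Subgroup (PlanarBraidGroup n) := (toPerm n).ker

/-! ### Crossing types -/

/-- A crossing type `I = (I_1, I_2, I_3)`: an ordered partition of the strands into three (possibly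
empty) blocks with `|I_2| = 2`. It is recorded by the function that sends a strand to the index of its
block, the indices being `0, 1, 2`: `I_r` is the fibre over `r - 1`. -/
@[ext] structure CrossingType (n : ℕ) where
  block : Fin n → Fin 3
  card_two : (Finset.univ.filter fun x => block x = 1).card = 2

/-- `I` is essential if some `x ∈ I_3` is greater than all `y ∈ I_2`. -/
def CrossingType.Essential {n : ℕ} (I : CrossingType n) : Prop :=
  ∃ x, I.block x = 2 ∧ ∀ y, I.block y = 1 → y < x

instance {n : ℕ} (I : CrossingType n) : Decidable I.Essential := by
  unfold CrossingType.Essential; infer_instance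

/-- A double crossing type `J = (J_1, …, J_5)`: an ordered partition of the strands into five
(possibly empty) blocks with `|J_2| = |J_4| = 2`; `J_r` is the fibre of `block` over `r - 1`. -/
@[ext] structure DoubleCrossingType (n : ℕ) where
  block : Fin n → Fin 5
  card_two : (Finset.univ.filter fun x => block x = 1).card = 2
  card_four : (Finset.univ.filter fun x => block x = 3).card = 2

/-- `J` is essential if some `x₁ ∈ J_3` is greater than all `y ∈ J_2` and
some `x₂ ∈ J_5` is greater than all `y ∈ J_4`. -/
def DoubleCrossingType.Essential {n : ℕ} (J : DoubleCrossingType n) : Prop :=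
  (∃ x, J.block x = 2 ∧ ∀ y, J.block y = 1 → y < x) ∧
    ∃ x, J.block x = 4 ∧ ∀ y, J.block y = 3 → y < x

/-- `J_{[1]} = (J_1, J_2, J_3 ⊔ J_4 ⊔ J_5)`. -/
def DoubleCrossingType.first {n : ℕ} (J : DoubleCrossingType n) : CrossingType n where
  block x := ![0, 1, 2, 2, 2] (J.block x)
  card_two := by
    have h : ∀ b : Fin 5, (![0, 1, 2, 2, 2] : Fin 5 → Fin 3) b = 1 ↔ b = 1 := by decide
    simpa only [h] using J.card_two

/-- `J_{[2]} = (J_1 ⊔ J_2 ⊔ J_3, J_4, J_5)`. -/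
def DoubleCrossingType.second {n : ℕ} (J : DoubleCrossingType n) : CrossingType n where
  block x := ![0, 0, 0, 1, 2] (J.block x)
  card_two := by
    have h : ∀ b : Fin 5, (![0, 0, 0, 1, 2] : Fin 5 → Fin 3) b = 1 ↔ b = 3 := by decide
    simpa only [h] using J.card_four

/-- The essential crossing types on `n` strands. -/
abbrev EssentialCrossingType (n : ℕ) : Type := {I : CrossingType n // I.Essential}

/-- The essential double crossing types on `n` strands. -/
abbrev EssentialDoubleCrossingType (n : ℕ) : Type := {J : DoubleCrossingType n // J.Essential}

/-- `J_{[1]}`, which is essential if `J` is. -/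
def EssentialDoubleCrossingType.first {n : ℕ} (J : EssentialDoubleCrossingType n) :
    EssentialCrossingType n :=
  ⟨J.1.first, by
    have h : ∀ b : Fin 5, (![0, 1, 2, 2, 2] : Fin 5 → Fin 3) b = 1 → b = 1 := by decide
    obtain ⟨x, hx, hxy⟩ := J.2.1
    exact ⟨x, by simp [DoubleCrossingType.first, hx], fun y hy => hxy y (h _ hy)⟩⟩

/-- `J_{[2]}`, which is essential if `J` is. -/
def EssentialDoubleCrossingType.second {n : ℕ} (J : EssentialDoubleCrossingType n) :
    EssentialCrossingType n :=
  ⟨J.1.second, by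
    have h : ∀ b : Fin 5, (![0, 0, 0, 1, 2] : Fin 5 → Fin 3) b = 1 → b = 3 := by decide
    obtain ⟨x, hx, hxy⟩ := J.2.2
    exact ⟨x, by simp [DoubleCrossingType.second, hx], fun y hy => hxy y (h _ hy)⟩⟩

/-! ### Arrangements of the strands and the descending spanning tree

A permutation `α` (sending strands to positions) is represented by the sequence
`s = (α⁻¹(1), …, α⁻¹(n))`, that is, by the permutation `s = α⁻¹` which sends a position to the strand
in it. Exchanging the strands in the positions `k` and `k + 1` replaces `s` by `s * tau k`. So the
vertices of the permutohedron are the arrangements `s`, and its edges join `s` to `s * tau k`; the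
edge from `s` to `s * tau k` is the labelled braid `[α, k]` with the underlying braid `σ_k`. -/

/-- The crossing type `(I_1^α, I_2^α, I_3^α)` of `[α, k]`, `s = α⁻¹`: the strands in the positions to
the left of `k`, in the positions `k, k + 1`, and to the right of `k + 1`. -/
def crossingType {n : ℕ} (s : Perm (Fin n)) (k : Fin (n - 1)) : CrossingType n where
  block x := if s⁻¹ x < lo k then 0 else if s⁻¹ x ≤ hi k then 1 else 2
  card_two := by
    have h : (Finset.univ.filter fun x =>
        (if s⁻¹ x < lo k then (0 : Fin 3) else if s⁻¹ x ≤ hi k then 1 else 2) = 1) =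
        ({lo k, hi k} : Finset (Fin n)).map s.toEmbedding := by
      ext x
      have hx : x ∈ ({lo k, hi k} : Finset (Fin n)).map s.toEmbedding ↔
          s⁻¹ x = lo k ∨ s⁻¹ x = hi k := by
        rw [Finset.mem_map_equiv]; simp [Perm.inv_def]
      rw [hx, Finset.mem_filter]
      generalize s⁻¹ x = p
      simp only [Finset.mem_univ, true_and, Fin.lt_def, Fin.le_def, Fin.ext_iff, lo, hi]
      split_ifs <;> simp <;> omega
    rw [h, Finset.card_map, Finset.card_pair]
    simp [lo, hi]

/-- The positions `m` such that `m` and `m + 1` are among the first `b` positions and the strands in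
them fail to be in decreasing order. -/
def ascents {n : ℕ} (s : Perm (Fin n)) (b : ℕ) : Finset (Fin (n - 1)) :=
  Finset.univ.filter fun m => m.val + 1 < b ∧ s (lo m) < s (hi m)

/-- An auxiliary number that drops on the way towards the root of the tree; it is only used to see
that the recursions below terminate. -/
def disorder {n : ℕ} (s : Perm (Fin n)) : ℕ := ∑ i : Fin n, i.val * (s i).val

theorem disorder_lt {n : ℕ} {s : Perm (Fin n)} {b : ℕ} {m : Fin (n - 1)} (hm : m ∈ ascents s b) :
    disorder (s * tau m) < disorder s := by
  have hlt : (s (lo m)).val < (s (hi m)).val := by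
    have := (Finset.mem_filter.mp hm).2.2
    exact this
  have hne : hi m ≠ lo m := by simp [lo, hi]
  have e : disorder (s * tau m) = ∑ i : Fin n, (tau m i).val * (s i).val := by
    unfold disorder
    rw [← Equiv.sum_comp (tau m)]
    simp [tau]
  have split : ∀ f : Fin n → ℕ, ∑ i, f i =
      f (lo m) + (f (hi m) + ∑ i ∈ (Finset.univ.erase (lo m)).erase (hi m), f i) := by
    intro f
    rw [Finset.add_sum_erase _ _ (by simp [hne]), Finset.add_sum_erase _ _ (by simp)]
  rw [e, disorder, split, split (fun i => i.val * (s i).val)]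
  have hrest : ∑ i ∈ (Finset.univ.erase (lo m)).erase (hi m), (tau m i).val * (s i).val =
      ∑ i ∈ (Finset.univ.erase (lo m)).erase (hi m), i.val * (s i).val := by
    refine Finset.sum_congr rfl fun i hi' => ?_
    simp only [Finset.mem_erase] at hi'
    rw [tau, swap_apply_of_ne_of_ne hi'.2.1 hi'.1]
  rw [hrest]
  have h1 : (tau m (lo m)).val = m.val + 1 := by simp [tau, hi]
  have h2 : (tau m (hi m)).val = m.val := by simp [tau, lo]
  have h3 : (lo m).val = m.val := rfl
  have h4 : (hi m).val = m.val + 1 := rfl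
  rw [h1, h2, h3, h4]
  nlinarith

/-- The planar braid that follows the descending spanning tree of the permutohedron from the vertex
`s` to the root, which is the decreasing arrangement: the parent of `s` is `s * tau m`, where `m` is
the rightmost position such that the strands in `m` and `m + 1` fail to be in decreasing order. -/
noncomputable def toRoot {n : ℕ} (s : Perm (Fin n)) : PlanarBraidGroup n :=
  if h : (ascents s n).Nonempty then
    sigma ((ascents s n).max' h) * toRoot (s * tau ((ascents s n).max' h))
  else 1
termination_by disorder s
decreasing_by exact disorder_lt (Finset.max'_mem _ h)

/-- The planar braid `t(s)` that follows the descending spanning tree from the identity to `s`. -/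
noncomputable def treeBraid {n : ℕ} (s : Perm (Fin n)) : PlanarBraidGroup n :=
  toRoot 1 * (toRoot s)⁻¹

/-- The planar pure braid `t(s) · [α, k] · t(s * tau k)⁻¹` defined by `[α, k]`, `s = α⁻¹`. -/
noncomputable def edgeBraid {n : ℕ} (s : Perm (Fin n)) (k : Fin (n - 1)) : PlanarBraidGroup n :=
  treeBraid s * sigma k * (treeBraid (s * tau k))⁻¹

/-! ### Decreasing generators -/

/-- The arrangement in which the blocks stand one after another from left to right and the strands of
every block are in decreasing order. -/
def decreasingArrangement {n b : ℕ} (block : Fin n → Fin b) : Perm (Fin n) :=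
  Tuple.sort fun x => toLex (block x, OrderDual.toDual x)

/-- The position `k = |I_1|` of the crossing in the decreasing generator of crossing type `I`. -/
def CrossingType.index {n : ℕ} (I : CrossingType n) : Fin (n - 1) :=
  ⟨(Finset.univ.filter fun x => I.block x = 0).card, by
    have h := Finset.card_le_univ
      ((Finset.univ.filter fun x => I.block x = 0) ∪ Finset.univ.filter fun x => I.block x = 1)
    rw [Finset.card_union_of_disjoint
      (Finset.disjoint_filter.mpr fun x _ h0 h1 => by simp [h0] at h1),
      I.card_two, Fintype.card_fin] at h
    omega⟩

/-- The planar pure braid that corresponds to a crossing type `I`: the one defined by the unique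
decreasing generator `[α, k]` of crossing type `I`. -/
noncomputable def CrossingType.braid {n : ℕ} (I : CrossingType n) : PlanarBraidGroup n :=
  edgeBraid (decreasingArrangement I.block) I.index

theorem DoubleCrossingType.card_le {n : ℕ} (J : DoubleCrossingType n) :
    (Finset.univ.filter fun x => J.block x = 0).card + 2 +
      (Finset.univ.filter fun x => J.block x = 2).card + 2 ≤ n := by
  have h := Finset.card_eq_sum_card_fiberwise (f := J.block) (s := Finset.univ) (t := Finset.univ)
    (fun _ _ => Finset.mem_coe.mpr (Finset.mem_univ _))
  have h1 := J.card_two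
  have h3 := J.card_four
  rw [Finset.card_univ, Fintype.card_fin, Fin.sum_univ_five] at h
  omega

/-- The position `k = |J_1|` of the left crossing in the decreasing triple `[α, k, l]` of double
crossing type `J`. -/
def DoubleCrossingType.leftIndex {n : ℕ} (J : DoubleCrossingType n) : Fin (n - 1) :=
  ⟨(Finset.univ.filter fun x => J.block x = 0).card, by have := J.card_le; omega⟩

/-- The position `l = |J_1| + |J_2| + |J_3|` of the right crossing in the decreasing triple
`[α, k, l]` of double crossing type `J`. -/
def DoubleCrossingType.rightIndex {n : ℕ} (J : DoubleCrossingType n) : Fin (n - 1) :=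
  ⟨(Finset.univ.filter fun x => J.block x = 0).card + 2 +
    (Finset.univ.filter fun x => J.block x = 2).card, by have := J.card_le; omega⟩

/-! ### The rewriting algorithm

Decreasing generators are identified with their crossing types. A word is a list of letters
`(I, true)`, standing for `I`, and `(I, false)`, standing for `I⁻¹`. -/

/-- Words in the crossing types (that is, in the decreasing generators). -/
abbrev Word (n : ℕ) : Type := List (CrossingType n × Bool)

/-- The word `w(α, k) = w · [α', k]^{±1} · w⁻¹` for `[α, k]`, `s = α⁻¹`, when `w` is the conjugating
word. Here `[α', k]` is the decreasing generator with the crossing type of `[α, k]`, and the exponent is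
`1` if the strands in the positions `k, k + 1` are in decreasing order and `-1` otherwise. -/
def wordOf {n : ℕ} (w : Word n) (s : Perm (Fin n)) (k : Fin (n - 1)) : Word n :=
  w ++ [(crossingType s k, decide (s (hi k) < s (lo k)))] ++ FreeGroup.invRev w

/-- The conjugating word of the rewriting algorithm for `[α, k]`, `s = α⁻¹`: as long as the strands
to the left of position `k` are not in decreasing order, the rightmost two adjacent of them, in the
positions `m, m + 1`, which fail to be so are exchanged, and the word `w(α, m)` is appended. The
order of the strands to the right of `k + 1` plays no role, since the algorithm only sees the
crossing types. -/
def conjWord {n : ℕ} (s : Perm (Fin n)) (k : Fin (n - 1)) : Word n :=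
  if h : (ascents s k.val).Nonempty then
    wordOf (conjWord s ((ascents s k.val).max' h)) s ((ascents s k.val).max' h) ++
      conjWord (s * tau ((ascents s k.val).max' h)) k
  else []
termination_by (k.val, disorder s)
decreasing_by
  · apply Prod.Lex.left
    have := (Finset.mem_filter.mp (Finset.max'_mem _ h)).2.1
    omega
  · exact Prod.Lex.right _ (disorder_lt (Finset.max'_mem _ h))

/-- Words in the essential crossing types. -/
abbrev EssentialWord (n : ℕ) : Type := List (EssentialCrossingType n × Bool)

/-- The word in the essential crossing types obtained by deleting the non-essential letters (which
represent the trivial pure braid). -/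
def essentialPart {n : ℕ} (w : Word n) : EssentialWord n :=
  w.filterMap fun a => if h : a.1.Essential then some (⟨a.1, h⟩, a.2) else none

/-- The word `u_J`: if `[α, k, l]` is the decreasing triple of double crossing type `J`, the algorithm
writes `[α, l]` as `u_J⁻¹ · J_{[2]} · u_J`. -/
def uWord {n : ℕ} (J : DoubleCrossingType n) : EssentialWord n :=
  essentialPart (FreeGroup.invRev (conjWord (decreasingArrangement J.block) J.rightIndex))

/-- The word `v_J`: if `[α, k, l]` is the decreasing triple of double crossing type `J`, the algorithm
writes `[α τ_k, l]` as `v_J⁻¹ · J_{[2]} · v_J`. -/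
def vWord {n : ℕ} (J : DoubleCrossingType n) : EssentialWord n :=
  essentialPart (FreeGroup.invRev
    (conjWord (decreasingArrangement J.block * tau J.leftIndex) J.rightIndex))

/-- The relator `r_J = [u_J J_{[1]} v_J⁻¹, J_{[2]}]`. -/
def relator {n : ℕ} (J : EssentialDoubleCrossingType n) : FreeGroup (EssentialCrossingType n) :=
  ⁅FreeGroup.mk (uWord J.1) * FreeGroup.of J.first * (FreeGroup.mk (vWord J.1))⁻¹,
    FreeGroup.of J.second⁆

end PlanarBraid

namespace PlanarBraid

open Equiv
open scoped commutatorElement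

variable {n : ℕ}

/-! ### Elementary transpositions -/

/-! The pairs [s,k] are the edges of the permutohedron. By Reidemeister–Schreier with the descending
tree, the pure group is generated by all edges, where opposite directions are inverse, tree edges
are trivial and each pair k+1 < l gives a commuting square at every s. If m is the last ascent to
the left of k, the square on m and k makes [s,k] a conjugate of [sτ_m,k] by [s,m]; iterating this is
the rewriting algorithm, so only one generator per crossing type survives. A non-essential type is
trivial, because its decreasing generator, read backwards, is a tree edge.

It remains to find which squares are needed. For an arbitrary function `f` on crossing types,
`edgeVal` labels the edges as the algorithm prescribes. By `square_iff` a square closes exactly when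
one element commutes with one letter. `squareVal_commute` reduces this, by induction over adjacent
squares and cubes, to squares whose strands decrease within the three position classes before l.
Such a square is automatic unless its double crossing type J is essential, and then it is precisely
r_J (`lift_relator_eq_one_iff`, `squareVal_letterClass`).

The isomorphism is built directly. The braids of edges obey the algorithm (`edgeBraid_eq_edgeVal`),
so the relators hold among braids and `toBraid` exists. For injectivity, the braid group acts on
pairs of an element of the presented group and an arrangement, with generators multiplying by edge
labels; the image of g sends (x,1) to (gx,1). Surjectivity onto the pure braids is the Schreier
telescoping `treeBraid_mul_mem_range`.

The claim about u_J and v_J rests on two facts: letters of a conjugating word sit strictly to the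
left of its crossing, and the algorithm never undoes an inversion. -/

@[simp] theorem lo_val (k : Fin (n - 1)) : (lo k).val = k.val := rfl

@[simp] theorem hi_val (k : Fin (n - 1)) : (hi k).val = k.val + 1 := rfl

theorem tau_val (k : Fin (n - 1)) (i : Fin n) :
    (tau k i).val = if i.val = k.val then k.val + 1 else if i.val = k.val + 1 then k.val else i.val := by
  unfold tau
  rw [swap_apply_def]
  simp only [Fin.ext_iff, lo_val, hi_val]
  split_ifs <;> simp

@[simp] theorem tau_lo (k : Fin (n - 1)) : tau k (lo k) = hi k := by simp [tau]

@[simp] theorem tau_hi (k : Fin (n - 1)) : tau k (hi k) = lo k := by simp [tau]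

theorem tau_of_lt {k : Fin (n - 1)} {i : Fin n} (h : i.val < k.val) : tau k i = i := by
  rw [Fin.ext_iff, tau_val]; split_ifs <;> omega

theorem tau_of_gt {k : Fin (n - 1)} {i : Fin n} (h : k.val + 1 < i.val) : tau k i = i := by
  rw [Fin.ext_iff, tau_val]; split_ifs <;> omega

@[simp] theorem tau_inv (k : Fin (n - 1)) : (tau k)⁻¹ = tau k := by simp [tau]

@[simp] theorem tau_mul_self (k : Fin (n - 1)) : tau k * tau k = 1 := by simp [tau]

@[simp] theorem mul_tau_tau (s : Perm (Fin n)) (k : Fin (n - 1)) : s * tau k * tau k = s := by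
  rw [mul_assoc, tau_mul_self, mul_one]

theorem tau_comm {k l : Fin (n - 1)} (h : k.val + 1 < l.val) : tau k * tau l = tau l * tau k := by
  ext i
  simp only [Perm.mul_apply, tau_val]
  split_ifs <;> omega

theorem mul_tau_comm (s : Perm (Fin n)) {k l : Fin (n - 1)} (h : k.val + 1 < l.val) :
    s * tau k * tau l = s * tau l * tau k := by
  rw [mul_assoc, tau_comm h, mul_assoc]

theorem sigma_mul_self (k : Fin (n - 1)) : sigma k * sigma k = 1 := by
  have := PresentedGroup.one_of_mem (rels := braidRels n) (x := FreeGroup.of k ^ 2) (Or.inl ⟨k, rfl⟩)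
  rwa [pow_two, map_mul] at this

theorem sigma_comm {k l : Fin (n - 1)} (h : k.val + 1 < l.val) :
    sigma k * sigma l = sigma l * sigma k := by
  have := PresentedGroup.one_of_mem (rels := braidRels n)
    (x := ⁅FreeGroup.of k, FreeGroup.of l⁆) (Or.inr ⟨k, l, h, rfl⟩)
  rw [map_commutatorElement, commutatorElement_eq_one_iff_mul_comm] at this
  exact this

@[simp] theorem toPerm_sigma (k : Fin (n - 1)) : toPerm n (sigma k) = tau k :=
  PresentedGroup.toGroup.of tau_rels

/-! ### Ascents -/

theorem mem_ascents {s : Perm (Fin n)} {b : ℕ} {m : Fin (n - 1)} :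
    m ∈ ascents s b ↔ m.val + 1 < b ∧ s (lo m) < s (hi m) := by simp [ascents]

theorem lo_ne_hi (m : Fin (n - 1)) : lo m ≠ hi m := by simp [Fin.ext_iff]

theorem not_ascent {s : Perm (Fin n)} {m : Fin (n - 1)} :
    ¬ s (lo m) < s (hi m) ↔ s (hi m) < s (lo m) := by
  have : s (lo m) ≠ s (hi m) := s.injective.ne (lo_ne_hi m)
  omega

theorem ascents_congr {s s' : Perm (Fin n)} {b : ℕ} (h : ∀ i : Fin n, i.val < b → s i = s' i) :
    ascents s b = ascents s' b := by
  ext m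
  simp only [mem_ascents]
  refine and_congr_right fun hm => ?_
  rw [h (lo m) (by simp; omega), h (hi m) (by simpa)]

/-- The positions from m on decide both that m is an ascent and that no later one is, so exchanges
farther left keep the last ascent. -/
theorem isGreatest_ascents_congr {s s' : Perm (Fin n)} {b : ℕ} {m : Fin (n - 1)}
    (h : ∀ i : Fin n, m.val ≤ i.val → s i = s' i) (hm : IsGreatest (ascents s b : Set (Fin (n - 1))) m) :
    IsGreatest (ascents s' b : Set (Fin (n - 1))) m := by
  constructor
  · have := mem_ascents.1 (Finset.mem_coe.1 hm.1)
    rw [h (lo m) (by simp), h (hi m) (by simp)] at this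
    exact mem_ascents.2 this
  · intro p hp
    by_contra hlt
    have hlt' : m.val < p.val := by simpa using hlt
    refine hlt (hm.2 ?_)
    have := mem_ascents.1 (Finset.mem_coe.1 hp)
    rw [← h (lo p) (by simp; omega), ← h (hi p) (by simp; omega)] at this
    exact mem_ascents.2 this

theorem disorder_mul_tau_lt {s : Perm (Fin n)} {m : Fin (n - 1)} (h : s (lo m) < s (hi m)) :
    disorder (s * tau m) < disorder s :=
  disorder_lt (b := m.val + 2) (mem_ascents.2 ⟨by omega, h⟩)

/-- A sequence without ascents between two positions decreases between them. -/
theorem lt_of_forall_descent {s : Perm (Fin n)} {a b : ℕ}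
    (h : ∀ m : Fin (n - 1), a ≤ m.val → m.val + 1 < b → ¬ s (lo m) < s (hi m)) {i j : Fin n}
    (hi' : a ≤ i.val) (hij : i < j) (hj : j.val < b) : s j < s i := by
  obtain ⟨j, hjn⟩ := j
  induction j with
  | zero => simp [Fin.lt_def] at hij
  | succ j ih =>
    have hstep := not_ascent.1 (h ⟨j, by omega⟩ (by simp [Fin.lt_def] at hij; simp; omega)
      (by simpa using hj))
    rcases Nat.lt_or_ge i.val j with hlt | hge
    · exact lt_trans hstep (ih (by omega) (by simpa [Fin.lt_def]) (by simp at hj ⊢; omega))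
    · have : i = ⟨j, by omega⟩ := by
        simp only [Fin.lt_def] at hij
        ext; simp; omega
      rw [this]; exact hstep

/-! ### Crossing types of edges -/

/-- The exchanged positions lie in the same one of the three classes cut out by k. -/
theorem crossingType_mul_tau (s : Perm (Fin n)) {k m : Fin (n - 1)}
    (h : m.val + 1 < k.val ∨ m = k ∨ k.val + 1 < m.val) :
    crossingType (s * tau m) k = crossingType s k := by
  ext x : 2
  simp only [crossingType, mul_inv_rev, tau_inv, Perm.mul_apply, Fin.lt_def, Fin.le_def, tau_val,
    lo_val, hi_val]
  generalize (s⁻¹ x).val = p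
  rw [Fin.ext_iff] at h
  split_ifs <;> first | rfl | omega

theorem crossingType_congr {s s' : Perm (Fin n)} {k : Fin (n - 1)}
    (h : ∀ i : Fin n, i.val ≤ k.val + 1 → s i = s' i) : crossingType s k = crossingType s' k := by
  have key : ∀ {s s' : Perm (Fin n)} (_ : ∀ i : Fin n, i.val ≤ k.val + 1 → s i = s' i) (x : Fin n),
      (s⁻¹ x).val ≤ k.val + 1 → s'⁻¹ x = s⁻¹ x := by
    intro s s' h x hx
    rw [Perm.inv_eq_iff_eq, ← h _ hx]; simp
  ext x : 2
  simp only [crossingType, Fin.lt_def, Fin.le_def, lo_val, hi_val]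
  by_cases hx : (s⁻¹ x).val ≤ k.val + 1
  · rw [key h x hx]
  · by_cases hx' : (s'⁻¹ x).val ≤ k.val + 1
    · rw [key (fun i hi' => (h i hi').symm) x hx']
    · split_ifs <;> first | rfl | omega

/-! ### Conjugating words -/

theorem conjWord_eq_nil {s : Perm (Fin n)} {k : Fin (n - 1)} (h : ascents s k.val = ∅) :
    conjWord s k = [] := by
  rw [conjWord, dif_neg (by simp [h])]

theorem conjWord_eq_append {s : Perm (Fin n)} {k m : Fin (n - 1)}
    (h : IsGreatest (ascents s k.val : Set (Fin (n - 1))) m) :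
    conjWord s k = wordOf (conjWord s m) s m ++ conjWord (s * tau m) k := by
  have hne : (ascents s k.val).Nonempty := ⟨m, h.1⟩
  have hm : (ascents s k.val).max' hne = m := (Finset.isGreatest_max' _ hne).unique h
  rw [conjWord, dif_pos hne, hm]

theorem exists_isGreatest_ascents {s : Perm (Fin n)} {b : ℕ} (h : (ascents s b).Nonempty) :
    ∃ m, IsGreatest (ascents s b : Set (Fin (n - 1))) m := ⟨_, Finset.isGreatest_max' _ h⟩

/-- The conjugating word depends only on the strands to the left of the crossing. -/
theorem conjWord_congr {s s' : Perm (Fin n)} {k : Fin (n - 1)}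
    (h : ∀ i : Fin n, i.val < k.val → s i = s' i) : conjWord s k = conjWord s' k := by
  rcases (ascents s k.val).eq_empty_or_nonempty with he | hne
  · rw [conjWord_eq_nil he, conjWord_eq_nil (ascents_congr h ▸ he)]
  · obtain ⟨m, hm⟩ := exists_isGreatest_ascents hne
    have hmem := mem_ascents.1 (Finset.mem_coe.1 hm.1)
    rw [conjWord_eq_append hm, conjWord_eq_append (s := s') (ascents_congr h ▸ hm),
      conjWord_congr (s := s) (s' := s') (k := m) fun i hi' => h i (by omega),
      conjWord_congr (s := s * tau m) (s' := s' * tau m) (k := k) fun i hi' => by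
        rw [Perm.mul_apply, Perm.mul_apply, h _ (by rw [tau_val]; split_ifs <;> omega)],
      wordOf, wordOf, crossingType_congr (s := s) (s' := s') fun i hi' => h i (by omega),
      h (lo m) (by simp; omega), h (hi m) (by simp; omega)]
termination_by (k.val, disorder s)
decreasing_by
  · exact Prod.Lex.left _ _ (by omega)
  · exact Prod.Lex.right _ (disorder_mul_tau_lt hmem.2)

/-! ### Values of the words in a group -/

section Values

variable {H : Type*} [Group H] (f : CrossingType n → H)

/-- The value of the conjugating word of `[s, k]`. -/
noncomputable def conjVal (s : Perm (Fin n)) (k : Fin (n - 1)) : H :=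
  FreeGroup.lift f (FreeGroup.mk (conjWord s k))

/-- The value of the crossing type of `[s, k]` with its sign. -/
noncomputable def letterVal (s : Perm (Fin n)) (k : Fin (n - 1)) : H :=
  if s (hi k) < s (lo k) then f (crossingType s k) else (f (crossingType s k))⁻¹

/-- The value of the word that the rewriting algorithm assigns to `[s, k]`. -/
noncomputable def edgeVal (s : Perm (Fin n)) (k : Fin (n - 1)) : H :=
  conjVal f s k * letterVal f s k * (conjVal f s k)⁻¹

theorem lift_wordOf (s : Perm (Fin n)) (k : Fin (n - 1)) :
    FreeGroup.lift f (FreeGroup.mk (wordOf (conjWord s k) s k)) = edgeVal f s k := by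
  rw [wordOf, ← FreeGroup.mul_mk, ← FreeGroup.mul_mk, ← FreeGroup.inv_mk, map_mul, map_mul, map_inv,
    edgeVal, conjVal]
  congr 2
  by_cases h : s (hi k) < s (lo k) <;> simp [letterVal, h]

theorem conjVal_eq_one {s : Perm (Fin n)} {k : Fin (n - 1)} (h : ascents s k.val = ∅) :
    conjVal f s k = 1 := by
  rw [conjVal, conjWord_eq_nil h, ← FreeGroup.one_eq_mk, map_one]

theorem conjVal_eq_mul {s : Perm (Fin n)} {k m : Fin (n - 1)}
    (h : IsGreatest (ascents s k.val : Set (Fin (n - 1))) m) :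
    conjVal f s k = edgeVal f s m * conjVal f (s * tau m) k := by
  rw [conjVal, conjWord_eq_append h, ← FreeGroup.mul_mk, map_mul, lift_wordOf, conjVal]

theorem conjVal_congr {s s' : Perm (Fin n)} {k : Fin (n - 1)}
    (h : ∀ i : Fin n, i.val < k.val → s i = s' i) : conjVal f s k = conjVal f s' k := by
  rw [conjVal, conjWord_congr h, conjVal]

theorem edgeVal_congr {s s' : Perm (Fin n)} {k : Fin (n - 1)}
    (h : ∀ i : Fin n, i.val ≤ k.val + 1 → s i = s' i) : edgeVal f s k = edgeVal f s' k := by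
  rw [edgeVal, edgeVal, letterVal, letterVal, crossingType_congr h,
    conjVal_congr f (s := s) (s' := s') fun i hi' => h i (by omega), h (lo k) (by simp),
    h (hi k) (by simp)]

theorem edgeVal_mul_tau {k l : Fin (n - 1)} (h : k.val + 1 < l.val) (s : Perm (Fin n)) :
    edgeVal f (s * tau l) k = edgeVal f s k :=
  edgeVal_congr f fun i hi' => by rw [Perm.mul_apply, tau_of_lt (by omega)]

theorem letterVal_mul_tau {k l : Fin (n - 1)} (h : k.val + 1 < l.val) (s : Perm (Fin n)) :
    letterVal f (s * tau k) l = letterVal f s l := by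
  rw [letterVal, letterVal, crossingType_mul_tau s (Or.inl h), Perm.mul_apply, Perm.mul_apply,
    tau_of_gt (i := lo l) (by rwa [lo_val]), tau_of_gt (i := hi l) (by rw [hi_val]; omega)]

theorem letterVal_mul_tau_self (s : Perm (Fin n)) (k : Fin (n - 1)) :
    letterVal f (s * tau k) k = (letterVal f s k)⁻¹ := by
  rw [letterVal, letterVal, crossingType_mul_tau s (Or.inr (Or.inl rfl)), Perm.mul_apply,
    Perm.mul_apply, tau_lo, tau_hi]
  by_cases h : s (hi k) < s (lo k)
  · rw [if_pos h, if_neg h.asymm]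
  · have := s.injective.ne (lo_ne_hi k)
    rw [if_neg h, if_pos (by omega), inv_inv]

theorem edgeVal_mul_tau_self (s : Perm (Fin n)) (k : Fin (n - 1)) :
    edgeVal f (s * tau k) k = (edgeVal f s k)⁻¹ := by
  rw [edgeVal, letterVal_mul_tau_self, edgeVal, conjVal_congr f (s := s * tau k) (s' := s)
    fun i hi' => by rw [Perm.mul_apply, tau_of_lt hi']]
  group

theorem edgeVal_of_descents {s : Perm (Fin n)} {k : Fin (n - 1)} (h : ascents s k.val = ∅)
    (hk : s (hi k) < s (lo k)) : edgeVal f s k = f (crossingType s k) := by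
  rw [edgeVal, conjVal_eq_one f h, letterVal, if_pos hk, one_mul, inv_one, mul_one]

/-- The element that has to commute with the crossing type of `[s, l]` for the square
`[s, k, l]` to commute. -/
noncomputable def squareVal (s : Perm (Fin n)) (k l : Fin (n - 1)) : H :=
  (conjVal f s l)⁻¹ * edgeVal f s k * conjVal f (s * tau k) l

/-! ### Commuting squares and their reduction to decreasing ones. -/

theorem commute_letterVal_iff (s : Perm (Fin n)) (k : Fin (n - 1)) (x : H) :
    Commute x (letterVal f s k) ↔ Commute x (f (crossingType s k)) := by
  unfold letterVal
  split_ifs <;> simp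

/-- Exchanging at k leaves the letter at l unchanged, so the two l-edges are conjugates of one
letter and the square compares their conjugators. The two k-edges have equal labels, since the
algorithm does not look beyond position k+1. -/
theorem square_iff {k l : Fin (n - 1)} (h : k.val + 1 < l.val) (s : Perm (Fin n)) :
    edgeVal f s k * edgeVal f (s * tau k) l = edgeVal f s l * edgeVal f s k ↔
      Commute (squareVal f s k l) (f (crossingType s l)) := by
  rw [← commute_letterVal_iff, commute_iff_eq, edgeVal.eq_1 f _ l, edgeVal.eq_1 f s l,
    letterVal_mul_tau f h, squareVal]
  generalize edgeVal f s k = x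
  generalize conjVal f s l = y
  generalize conjVal f (s * tau k) l = z
  generalize letterVal f s l = a
  constructor
  · intro e
    calc y⁻¹ * x * z * a = y⁻¹ * (x * (z * a * z⁻¹)) * z := by group
      _ = a * (y⁻¹ * x * z) := by rw [e]; group
  · intro e
    calc x * (z * a * z⁻¹) = y * (y⁻¹ * x * z * a) * z⁻¹ := by group
      _ = y * a * y⁻¹ * x := by rw [e]; group

/-- The blocks of positions to the left of `l` that are separated by `k` are in decreasing order. -/
structure BlocksDecrease (s : Perm (Fin n)) (k l : ℕ) : Prop where
  left : ∀ m : Fin (n - 1), m.val + 1 < k → s (hi m) < s (lo m)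
  middle : ∀ m : Fin (n - 1), m.val = k → s (hi m) < s (lo m)
  right : ∀ m : Fin (n - 1), k + 2 ≤ m.val → m.val + 1 < l → s (hi m) < s (lo m)

/-- Each ascent inside a position class is removed by passing to a neighbouring square. The
induction on (l, k, disorder) works because the auxiliary squares have a smaller right index, or the
same one and a smaller left index. -/
theorem squareVal_commute
    (hbase : ∀ (s : Perm (Fin n)) (k l : Fin (n - 1)), k.val + 1 < l.val →
      BlocksDecrease s k l → Commute (squareVal f s k l) (f (crossingType s l)))
    (s : Perm (Fin n)) (k l : Fin (n - 1)) (h : k.val + 1 < l.val) :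
    Commute (squareVal f s k l) (f (crossingType s l)) := by
  -- An ascent at k: the same square read from its other end has the inverse `squareVal`.
  by_cases h2 : s (lo k) < s (hi k)
  · have ih := squareVal_commute hbase (s * tau k) k l h
    rw [crossingType_mul_tau s (Or.inl h)] at ih
    have e : squareVal f s k l = (squareVal f (s * tau k) k l)⁻¹ := by
      rw [squareVal, squareVal, edgeVal_mul_tau_self, mul_tau_tau]
      group
    rw [e]
    exact ih.inv_left
  -- An ascent between the crossings: both conjugating words at l begin with the edge at m, and the
  -- square on k and m cancels these factors, leaving the `squareVal` at sτ_m.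
  by_cases h3 : ∃ m, IsGreatest (ascents s l.val : Set (Fin (n - 1))) m ∧ k.val + 2 ≤ m.val
  · obtain ⟨m, hm, hkm⟩ := h3
    have hmem := mem_ascents.1 (Finset.mem_coe.1 hm.1)
    have ih := squareVal_commute hbase (s * tau m) k l h
    rw [crossingType_mul_tau s (Or.inl hmem.1)] at ih
    have hsq := (square_iff f (by omega) s).2 (squareVal_commute hbase s k m (by omega))
    have hm' : IsGreatest (ascents (s * tau k) l.val : Set (Fin (n - 1))) m :=
      isGreatest_ascents_congr (fun i hi' => by rw [Perm.mul_apply, tau_of_gt (by omega)]) hm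
    have e : squareVal f s k l = squareVal f (s * tau m) k l := by
      rw [squareVal, squareVal, conjVal_eq_mul f hm, conjVal_eq_mul f hm',
        edgeVal_mul_tau f (k := k) (l := m) (by omega), mul_tau_comm s (k := k) (l := m) (by omega)]
      calc _ = (conjVal f (s * tau m) l)⁻¹ * (edgeVal f s m)⁻¹ *
            (edgeVal f s k * edgeVal f (s * tau k) m) * conjVal f (s * tau m * tau k) l := by group
        _ = _ := by rw [hsq]; group
    rw [e]
    exact ih
  -- An ascent p to the left of k: in the cube on p, k, l, the square on p and k expresses this
  -- `squareVal` through those of three other faces, all of which have the same crossing type at l.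
  by_cases h1 : (ascents s k.val).Nonempty
  · obtain ⟨p, hp⟩ := h1
    have hmem := mem_ascents.1 hp
    have ih := squareVal_commute hbase (s * tau p) k l h
    have ih1 := squareVal_commute hbase s p l (by omega)
    have ih2 := squareVal_commute hbase (s * tau k) p l (by omega)
    rw [crossingType_mul_tau s (Or.inl (by omega))] at ih ih2
    have hsq := (square_iff f (by omega) s).2 (squareVal_commute hbase s p k (by omega))
    have e : squareVal f s k l =
        squareVal f s p l * squareVal f (s * tau p) k l * (squareVal f (s * tau k) p l)⁻¹ := by
      rw [squareVal, squareVal, squareVal, squareVal, edgeVal_mul_tau f (k := p) (l := k) (by omega),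
        ← mul_tau_comm s (k := p) (l := k) (by omega)]
      calc _ = (conjVal f s l)⁻¹ * (edgeVal f s k * edgeVal f s p) * (edgeVal f s p)⁻¹ *
            conjVal f (s * tau k) l := by group
        _ = _ := by rw [← hsq]; group
    rw [e]
    exact (ih1.mul_left ih).mul_left ih2.inv_left
  · refine hbase s k l h ⟨fun m hm => not_ascent.1 fun ha => h1 ⟨m, mem_ascents.2 ⟨hm, ha⟩⟩,
      fun m hm => ?_, fun m hkm hml => not_ascent.1 fun ha => h3 ?_⟩
    · rw [Fin.ext hm]; exact not_ascent.1 h2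
    · have hmem : m ∈ ascents s l.val := mem_ascents.2 ⟨hml, ha⟩
      obtain ⟨q, hq⟩ := exists_isGreatest_ascents ⟨m, hmem⟩
      exact ⟨q, hq, hkm.trans (hq.2 hmem)⟩
termination_by (l.val, k.val, disorder s)
decreasing_by
  · exact Prod.Lex.right _ (Prod.Lex.right _ (disorder_mul_tau_lt h2))
  · exact Prod.Lex.right _ (Prod.Lex.right _ (disorder_mul_tau_lt hmem.2))
  · exact Prod.Lex.left _ _ (by omega)
  · exact Prod.Lex.right _ (Prod.Lex.right _ (disorder_mul_tau_lt hmem.2))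
  · exact Prod.Lex.right _ (Prod.Lex.left _ _ (by omega))
  · exact Prod.Lex.right _ (Prod.Lex.left _ _ (by omega))
  · exact Prod.Lex.left _ _ (by omega)

end Values

/-! ### Decreasing arrangements -/

theorem inv_apply (s : Perm (Fin n)) (i : Fin n) : s⁻¹ (s i) = i := by simp

/-- The strand `x` precedes `y` in the decreasing arrangement of `block`. -/
def Precedes {b : ℕ} (block : Fin n → Fin b) (x y : Fin n) : Prop :=
  block x < block y ∨ block x = block y ∧ y < x

instance {b : ℕ} (block : Fin n → Fin b) : DecidableRel (Precedes block) := fun _ _ => by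
  unfold Precedes; infer_instance

theorem decreasingArrangement_precedes_iff {b : ℕ} (block : Fin n → Fin b) {i j : Fin n} :
    Precedes block (decreasingArrangement block i) (decreasingArrangement block j) ↔ i < j := by
  let f : Fin n → Fin b ×ₗ (Fin n)ᵒᵈ := fun x => toLex (block x, OrderDual.toDual x)
  have hf : Function.Injective f := fun x y h => by
    have := congrArg (fun z => (ofLex z).2) h
    exact OrderDual.toDual.injective this
  have hmono : StrictMono (f ∘ decreasingArrangement block) :=
    (Tuple.monotone_sort f).strictMono_of_injective
      (hf.comp (decreasingArrangement block).injective)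
  rw [← hmono.lt_iff_lt]
  simp only [f, Function.comp, Prod.Lex.toLex_lt_toLex, OrderDual.toDual_lt_toDual, Precedes]

theorem card_filter_inv_lt (s : Perm (Fin n)) {c : ℕ} (hc : c ≤ n) :
    (Finset.univ.filter fun x => (s⁻¹ x).val < c).card = c := by
  have : (Finset.univ.filter fun x => (s⁻¹ x).val < c) =
      (Finset.univ.filter fun i : Fin n => i.val < c).map s.toEmbedding := by
    ext x
    simp [Finset.mem_map_equiv, Perm.inv_def]
  rw [this, Finset.card_map, Fin.card_filter_val_lt, min_eq_right hc]

/-- The position of a strand is its number of predecessors; this recovers an arrangement from the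
precedence relation. -/
theorem card_filter_precedes {b : ℕ} {block : Fin n → Fin b} {s : Perm (Fin n)} {i : Fin n}
    (h : ∀ j, Precedes block (s j) (s i) ↔ j < i) :
    (Finset.univ.filter fun x => Precedes block x (s i)).card = i.val := by
  rw [← card_filter_inv_lt s i.isLt.le]
  congr 1
  ext x
  obtain ⟨j, rfl⟩ := s.surjective x
  simp only [Finset.mem_filter, Finset.mem_univ, true_and, h, inv_apply, Fin.lt_def]

/-- An arrangement whose first positions are filled in the order of the blocks, decreasingly in
every block, starts like the decreasing arrangement. -/
theorem decreasingArrangement_apply {b : ℕ} {block : Fin n → Fin b} {s : Perm (Fin n)} {L : ℕ}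
    (h : ∀ i j : Fin n, i < j → i.val < L → Precedes block (s i) (s j)) {i : Fin n}
    (hi' : i.val < L) : decreasingArrangement block i = s i := by
  have asymm : ∀ x y : Fin n, Precedes block x y → ¬ Precedes block y x := by
    rintro x y (h | h) (h' | h') <;> omega
  have irrefl : ∀ x : Fin n, ¬ Precedes block x x := by
    rintro x (h | h) <;> omega
  have h1 : ∀ j, Precedes block (s j) (s i) ↔ j < i := by
    intro j
    rcases lt_trichotomy j i with hlt | rfl | hgt
    · exact iff_of_true (h j i hlt (by omega)) hlt
    · exact iff_of_false (irrefl _) (lt_irrefl _)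
    · exact iff_of_false (asymm _ _ (h i j hgt hi')) hgt.asymm
  obtain ⟨i', hi''⟩ := (decreasingArrangement block).surjective (s i)
  have h2 := card_filter_precedes (block := block) (s := decreasingArrangement block) (i := i')
    fun j => decreasingArrangement_precedes_iff block
  rw [hi'', card_filter_precedes h1] at h2
  rw [← hi'', Fin.ext h2]

theorem block_decreasingArrangement_lt_iff {b : ℕ} (block : Fin n → Fin b) (c : Fin b) (i : Fin n) :
    block (decreasingArrangement block i) < c ↔
      i.val < (Finset.univ.filter fun x => block x < c).card := by
  have h := card_filter_precedes (block := block) (s := decreasingArrangement block) (i := i)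
    fun j => decreasingArrangement_precedes_iff block
  constructor
  · intro hlt
    rw [← h]
    refine Finset.card_lt_card ⟨fun x hx => ?_, fun hsub => ?_⟩
    · simp only [Finset.mem_filter, Finset.mem_univ, true_and] at hx ⊢
      unfold Precedes at hx
      omega
    · have := @hsub (decreasingArrangement block i) (by simpa using hlt)
      exact absurd (Finset.mem_filter.1 this).2 (by simp [Precedes])
  · intro hlt
    by_contra hge
    refine absurd hlt (not_lt.2 ?_)
    rw [← h]
    refine Finset.card_le_card fun x hx => ?_
    simp only [Finset.mem_filter, Finset.mem_univ, true_and] at hx ⊢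
    unfold Precedes
    omega

theorem decreasingArrangement_descent {b : ℕ} {block : Fin n → Fin b} {m : Fin (n - 1)}
    (h : block (decreasingArrangement block (lo m)) = block (decreasingArrangement block (hi m))) :
    decreasingArrangement block (hi m) < decreasingArrangement block (lo m) := by
  have := (decreasingArrangement_precedes_iff block (i := lo m) (j := hi m)).2 (by simp [Fin.lt_def])
  simp only [Precedes, h, lt_irrefl, true_and, false_or] at this
  exact this

theorem card_filter_or {α : Type*} [Fintype α] {p q r : α → Prop} [DecidablePred p]
    [DecidablePred q] [DecidablePred r] (h : ∀ x, p x ↔ q x ∨ r x) (hd : ∀ x, q x → ¬ r x) :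
    (Finset.univ.filter p).card = (Finset.univ.filter q).card + (Finset.univ.filter r).card := by
  classical
  rw [← Finset.card_union_of_disjoint (Finset.disjoint_filter.2 fun x _ => hd x)]
  congr 1
  ext x
  simp [h x]

theorem CrossingType.card_lt_one (I : CrossingType n) :
    (Finset.univ.filter fun x => I.block x < 1).card = I.index.val := by
  simp only [CrossingType.index]
  congr 1
  ext x
  simp only [Finset.mem_filter, Finset.mem_univ, true_and]
  omega

theorem CrossingType.card_lt_two (I : CrossingType n) :
    (Finset.univ.filter fun x => I.block x < 2).card = I.index.val + 2 := by
  rw [card_filter_or (q := fun x => I.block x < 1) (r := fun x => I.block x = 1)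
    (fun x => by omega) (fun x => by omega), I.card_lt_one, I.card_two]

theorem DoubleCrossingType.card_lt_one (J : DoubleCrossingType n) :
    (Finset.univ.filter fun x => J.block x < 1).card = J.leftIndex.val := by
  simp only [DoubleCrossingType.leftIndex]
  congr 1
  ext x
  simp only [Finset.mem_filter, Finset.mem_univ, true_and]
  omega

theorem DoubleCrossingType.card_lt_two (J : DoubleCrossingType n) :
    (Finset.univ.filter fun x => J.block x < 2).card = J.leftIndex.val + 2 := by
  rw [card_filter_or (q := fun x => J.block x < 1) (r := fun x => J.block x = 1)
    (fun x => by omega) (fun x => by omega), J.card_lt_one, J.card_two]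

theorem DoubleCrossingType.card_lt_three (J : DoubleCrossingType n) :
    (Finset.univ.filter fun x => J.block x < 3).card = J.rightIndex.val := by
  rw [card_filter_or (q := fun x => J.block x < 2) (r := fun x => J.block x = 2)
    (fun x => by omega) (fun x => by omega), J.card_lt_two]
  rfl

theorem DoubleCrossingType.card_lt_four (J : DoubleCrossingType n) :
    (Finset.univ.filter fun x => J.block x < 4).card = J.rightIndex.val + 2 := by
  rw [card_filter_or (q := fun x => J.block x < 3) (r := fun x => J.block x = 3)
    (fun x => by omega) (fun x => by omega), J.card_lt_three, J.card_four]

/-! ### Passing between types and decreasing arrangements. -/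

theorem crossingType_eq_of_forall {s : Perm (Fin n)} {k : Fin (n - 1)} {I : CrossingType n}
    (h1 : ∀ i, I.block (s i) < 1 ↔ i.val < k.val) (h2 : ∀ i, I.block (s i) < 2 ↔ i.val < k.val + 2) :
    crossingType s k = I := by
  ext x : 2
  obtain ⟨i, rfl⟩ := s.surjective x
  have h1 := h1 i
  have h2 := h2 i
  simp only [crossingType, inv_apply, Fin.lt_def, Fin.le_def, lo_val, hi_val]
  split_ifs <;> omega

theorem crossingType_decreasingArrangement (I : CrossingType n) :
    crossingType (decreasingArrangement I.block) I.index = I :=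
  crossingType_eq_of_forall
    (fun i => by rw [block_decreasingArrangement_lt_iff, I.card_lt_one])
    (fun i => by rw [block_decreasingArrangement_lt_iff, I.card_lt_two])

theorem blocksDecrease_decreasingArrangement (I : CrossingType n) :
    BlocksDecrease (decreasingArrangement I.block) I.index.val n := by
  have h1 := block_decreasingArrangement_lt_iff I.block 1
  have h2 := block_decreasingArrangement_lt_iff I.block 2
  rw [I.card_lt_one] at h1
  rw [I.card_lt_two] at h2
  constructor <;> intro m <;> intros <;> apply decreasingArrangement_descent <;>
    have h1l := h1 (lo m) <;> have h1h := h1 (hi m) <;>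
    have h2l := h2 (lo m) <;> have h2h := h2 (hi m) <;>
    simp only [lo_val, hi_val] at h1l h1h h2l h2h <;> omega

theorem DoubleCrossingType.crossingType_left (J : DoubleCrossingType n) :
    crossingType (decreasingArrangement J.block) J.leftIndex = J.first := by
  have e1 : ∀ b : Fin 5, (![0, 1, 2, 2, 2] : Fin 5 → Fin 3) b < 1 ↔ b < 1 := by decide
  have e2 : ∀ b : Fin 5, (![0, 1, 2, 2, 2] : Fin 5 → Fin 3) b < 2 ↔ b < 2 := by decide
  refine crossingType_eq_of_forall (fun i => ?_) (fun i => ?_)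
  · rw [DoubleCrossingType.first, e1, block_decreasingArrangement_lt_iff, J.card_lt_one]
  · rw [DoubleCrossingType.first, e2, block_decreasingArrangement_lt_iff, J.card_lt_two]

theorem DoubleCrossingType.crossingType_right (J : DoubleCrossingType n) :
    crossingType (decreasingArrangement J.block) J.rightIndex = J.second := by
  have e1 : ∀ b : Fin 5, (![0, 0, 0, 1, 2] : Fin 5 → Fin 3) b < 1 ↔ b < 3 := by decide
  have e2 : ∀ b : Fin 5, (![0, 0, 0, 1, 2] : Fin 5 → Fin 3) b < 2 ↔ b < 4 := by decide
  refine crossingType_eq_of_forall (fun i => ?_) (fun i => ?_)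
  · rw [DoubleCrossingType.second, e1, block_decreasingArrangement_lt_iff, J.card_lt_three]
  · rw [DoubleCrossingType.second, e2, block_decreasingArrangement_lt_iff, J.card_lt_four]

theorem DoubleCrossingType.leftIndex_lt (J : DoubleCrossingType n) :
    J.leftIndex.val + 1 < J.rightIndex.val := by
  simp only [DoubleCrossingType.leftIndex, DoubleCrossingType.rightIndex]
  omega

theorem DoubleCrossingType.blocksDecrease (J : DoubleCrossingType n) :
    BlocksDecrease (decreasingArrangement J.block) J.leftIndex.val J.rightIndex.val := by
  have h1 := block_decreasingArrangement_lt_iff J.block 1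
  have h2 := block_decreasingArrangement_lt_iff J.block 2
  have h3 := block_decreasingArrangement_lt_iff J.block 3
  rw [J.card_lt_one] at h1
  rw [J.card_lt_two] at h2
  rw [J.card_lt_three] at h3
  constructor <;> intro m <;> intros <;> apply decreasingArrangement_descent <;>
    have h1l := h1 (lo m) <;> have h1h := h1 (hi m) <;>
    have h2l := h2 (lo m) <;> have h2h := h2 (hi m) <;>
    have h3l := h3 (lo m) <;> have h3h := h3 (hi m) <;>
    simp only [lo_val, hi_val] at h1l h1h h2l h2h h3l h3h <;> omega

/-- The position classes determined by the crossings `k` and `l`. -/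
def positionBlock (k l p : ℕ) : Fin 5 :=
  if p < k then 0 else if p < k + 2 then 1 else if p < l then 2 else if p < l + 2 then 3 else 4

/-- The double crossing type of `[s, k, l]`. -/
def doubleCrossingType (s : Perm (Fin n)) (k l : Fin (n - 1)) (h : k.val + 1 < l.val) :
    DoubleCrossingType n where
  block x := positionBlock k l (s⁻¹ x).val
  card_two := by
    rw [← (crossingType s k).card_two]
    congr 1
    ext x
    simp only [Finset.mem_filter, Finset.mem_univ, true_and]
    simp only [positionBlock, crossingType, Fin.lt_def, Fin.le_def, lo_val, hi_val]
    generalize (s⁻¹ x).val = p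
    split_ifs <;> simp <;> omega
  card_four := by
    rw [← (crossingType s l).card_two]
    congr 1
    ext x
    simp only [Finset.mem_filter, Finset.mem_univ, true_and]
    simp only [positionBlock, crossingType, Fin.lt_def, Fin.le_def, lo_val, hi_val]
    generalize (s⁻¹ x).val = p
    split_ifs <;> simp <;> omega

theorem index_crossingType (s : Perm (Fin n)) (k : Fin (n - 1)) : (crossingType s k).index = k := by
  rw [Fin.ext_iff, ← CrossingType.card_lt_one, ← card_filter_inv_lt s (c := k.val) (by omega)]
  congr 1
  ext x
  simp only [Finset.mem_filter, Finset.mem_univ, true_and]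
  simp only [crossingType, Fin.lt_def, Fin.le_def, lo_val, hi_val]
  generalize (s⁻¹ x).val = p
  split_ifs <;> simp <;> omega

theorem leftIndex_doubleCrossingType (s : Perm (Fin n)) (k l : Fin (n - 1))
    (h : k.val + 1 < l.val) : (doubleCrossingType s k l h).leftIndex = k := by
  rw [Fin.ext_iff, ← DoubleCrossingType.card_lt_one, ← card_filter_inv_lt s (c := k.val) (by omega)]
  congr 1
  ext x
  simp only [Finset.mem_filter, Finset.mem_univ, true_and]
  simp only [doubleCrossingType, positionBlock]
  generalize (s⁻¹ x).val = p
  split_ifs <;> simp [Fin.lt_def] <;> omega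

theorem rightIndex_doubleCrossingType (s : Perm (Fin n)) (k l : Fin (n - 1))
    (h : k.val + 1 < l.val) : (doubleCrossingType s k l h).rightIndex = l := by
  rw [Fin.ext_iff, ← DoubleCrossingType.card_lt_three,
    ← card_filter_inv_lt s (c := l.val) (by omega)]
  congr 1
  ext x
  simp only [Finset.mem_filter, Finset.mem_univ, true_and]
  simp only [doubleCrossingType, positionBlock]
  generalize (s⁻¹ x).val = p
  split_ifs <;> simp [Fin.lt_def] <;> omega

theorem second_doubleCrossingType (s : Perm (Fin n)) (k l : Fin (n - 1)) (h : k.val + 1 < l.val) :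
    (doubleCrossingType s k l h).second = crossingType s l := by
  ext x : 2
  simp only [DoubleCrossingType.second, doubleCrossingType, positionBlock, crossingType, Fin.lt_def,
    Fin.le_def, lo_val, hi_val]
  split_ifs <;> first | rfl | omega

theorem BlocksDecrease.lt {s : Perm (Fin n)} {k l : ℕ} (h : BlocksDecrease s k l) {i j : Fin n}
    (hij : i < j) (hb : j.val < k ∨ k ≤ i.val ∧ j.val < k + 2 ∨ k + 2 ≤ i.val ∧ j.val < l) :
    s j < s i := by
  rcases hb with hb | ⟨ha, hb⟩ | ⟨ha, hb⟩
  · exact lt_of_forall_descent (a := 0) (fun m _ hm => not_ascent.2 (h.left m hm)) (by omega) hij hb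
  · exact lt_of_forall_descent (fun m hm hm' => not_ascent.2 (h.middle m (by omega))) ha hij hb
  · exact lt_of_forall_descent (fun m hm hm' => not_ascent.2 (h.right m hm hm')) ha hij hb

/-- Nothing is assumed about the order from position l on, so agreement is claimed only before l;
the conjugating words at l see no more. -/
theorem decreasingArrangement_doubleCrossingType {s : Perm (Fin n)} {k l : Fin (n - 1)}
    (h : k.val + 1 < l.val) (hs : BlocksDecrease s k.val l.val) {i : Fin n} (hi' : i.val < l.val) :
    decreasingArrangement (doubleCrossingType s k l h).block i = s i := by
  refine decreasingArrangement_apply (fun i j hij hil => ?_) hi'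
  have := hs.lt hij
  rw [Fin.lt_def] at hij
  simp only [Precedes, doubleCrossingType, inv_apply, positionBlock]
  split_ifs <;> simp <;> omega

theorem decreasingArrangement_crossingType {s : Perm (Fin n)} {k : Fin (n - 1)}
    (hs : BlocksDecrease s k.val n) : decreasingArrangement (crossingType s k).block = s := by
  ext1 i
  refine decreasingArrangement_apply (fun i j hij _ => ?_) i.isLt
  have := hs.lt hij
  rw [Fin.lt_def] at hij
  simp only [Precedes, crossingType, inv_apply, Fin.lt_def, Fin.le_def, lo_val, hi_val]
  split_ifs <;> simp <;> omega

/-! ### Ascents and essential types. -/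

theorem BlocksDecrease.ascents_eq_empty {s : Perm (Fin n)} {k l : ℕ} (h : BlocksDecrease s k l) :
    ascents s k = ∅ :=
  Finset.eq_empty_of_forall_notMem fun m hm =>
    (h.left m (mem_ascents.1 hm).1).asymm (mem_ascents.1 hm).2

/-- If the strands in the middle block are smaller than the greatest strand of the crossing, then
the crossing is the last ascent after its strands have been exchanged. -/
theorem isGreatest_ascents_mul_tau {s : Perm (Fin n)} {k : Fin (n - 1)} {l : ℕ}
    (hl : k.val + 1 < l) (hs : BlocksDecrease s k.val l)
    (h : ∀ i : Fin n, k.val + 2 ≤ i.val → i.val < l → s i < s (lo k)) :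
    IsGreatest (ascents (s * tau k) l : Set (Fin (n - 1))) k := by
  constructor
  · refine mem_ascents.2 ⟨hl, ?_⟩
    rw [Perm.mul_apply, Perm.mul_apply, tau_lo, tau_hi]
    exact hs.middle k rfl
  · intro p hp
    by_contra hkp
    have hkp : k.val < p.val := by simpa using hkp
    have hp := mem_ascents.1 (Finset.mem_coe.1 hp)
    rw [Perm.mul_apply, Perm.mul_apply, tau_of_gt (i := hi p) (by simpa)] at hp
    rcases Nat.lt_or_ge (k.val + 1) p.val with hlt | hge
    · rw [tau_of_gt (i := lo p) (by simpa)] at hp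
      exact (hs.right p hlt hp.1).asymm hp.2
    · have : lo p = hi k := Fin.ext (by simp; omega)
      rw [this, tau_hi] at hp
      exact (h (hi p) (by simp; omega) (by simpa using hp.1)).asymm hp.2

theorem essential_crossingType_iff {s : Perm (Fin n)} {k : Fin (n - 1)} :
    (crossingType s k).Essential ↔
      ∃ i : Fin n, k.val + 2 ≤ i.val ∧ s (lo k) < s i ∧ s (hi k) < s i := by
  have h1 : ∀ i, (crossingType s k).block (s i) = 1 ↔ i = lo k ∨ i = hi k := fun i => by
    simp only [crossingType, inv_apply, Fin.lt_def, Fin.le_def, Fin.ext_iff, lo_val, hi_val]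
    split_ifs <;> simp <;> omega
  have h2 : ∀ i, (crossingType s k).block (s i) = 2 ↔ k.val + 2 ≤ i.val := fun i => by
    simp only [crossingType, inv_apply, Fin.lt_def, Fin.le_def, lo_val, hi_val]
    split_ifs <;> simp <;> omega
  rw [CrossingType.Essential, s.surjective.exists]
  refine exists_congr fun i => ?_
  rw [s.surjective.forall, h2]
  simp only [h1, forall_eq_or_imp, forall_eq]

theorem essential_doubleCrossingType_iff {s : Perm (Fin n)} {k l : Fin (n - 1)}
    {h : k.val + 1 < l.val} :
    (doubleCrossingType s k l h).Essential ↔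
      (∃ i : Fin n, k.val + 2 ≤ i.val ∧ i.val < l.val ∧ s (lo k) < s i ∧ s (hi k) < s i) ∧
        (crossingType s l).Essential := by
  have h1 : ∀ i, (doubleCrossingType s k l h).block (s i) = 1 ↔ i = lo k ∨ i = hi k := fun i => by
    simp only [doubleCrossingType, positionBlock, inv_apply, Fin.ext_iff, lo_val, hi_val]
    split_ifs <;> simp <;> omega
  have h2 : ∀ i, (doubleCrossingType s k l h).block (s i) = 2 ↔
      k.val + 2 ≤ i.val ∧ i.val < l.val := fun i => by
    simp only [doubleCrossingType, positionBlock, inv_apply]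
    split_ifs <;> simp <;> omega
  have h3 : ∀ i, (doubleCrossingType s k l h).block (s i) = 3 ↔ i = lo l ∨ i = hi l := fun i => by
    simp only [doubleCrossingType, positionBlock, inv_apply, Fin.ext_iff, lo_val, hi_val]
    split_ifs <;> simp <;> omega
  have h4 : ∀ i, (doubleCrossingType s k l h).block (s i) = 4 ↔ l.val + 2 ≤ i.val := fun i => by
    simp only [doubleCrossingType, positionBlock, inv_apply]
    split_ifs <;> simp <;> omega
  rw [essential_crossingType_iff, DoubleCrossingType.Essential]
  refine and_congr (s.surjective.exists.trans (exists_congr fun i => ?_))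
    (s.surjective.exists.trans (exists_congr fun i => ?_))
  · rw [s.surjective.forall, h2]
    simp only [h1, forall_eq_or_imp, forall_eq, and_assoc]
  · rw [s.surjective.forall, h4]
    simp only [h3, forall_eq_or_imp, forall_eq]

/-- The crossing type of an edge of the descending spanning tree is not essential. -/
theorem not_essential_of_isGreatest {s : Perm (Fin n)} {m : Fin (n - 1)}
    (h : IsGreatest (ascents s n : Set (Fin (n - 1))) m) : ¬ (crossingType s m).Essential := by
  rw [essential_crossingType_iff]
  rintro ⟨i, hi', -, hlt⟩
  -- Behind the last ascent the strands decrease, so the strand at `hi m` exceeds all strands to its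
  -- right.
  refine (lt_of_forall_descent (s := s) (a := m.val + 1) (b := n) (i := hi m) (j := i)
    (fun p hp hpn ha => ?_) (by simp) (by simp [Fin.lt_def]; omega) i.isLt).asymm hlt
  have : p.val ≤ m.val := h.2 (mem_ascents.2 ⟨hpn, ha⟩)
  omega

/-! ### Pure braids of edges -/

theorem toRoot_eq_one {s : Perm (Fin n)} (h : ascents s n = ∅) : toRoot s = 1 := by
  rw [toRoot, dif_neg (by simp [h])]

theorem toRoot_eq_mul {s : Perm (Fin n)} {m : Fin (n - 1)}
    (h : IsGreatest (ascents s n : Set (Fin (n - 1))) m) :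
    toRoot s = sigma m * toRoot (s * tau m) := by
  have hne : (ascents s n).Nonempty := ⟨m, h.1⟩
  have hm : (ascents s n).max' hne = m := (Finset.isGreatest_max' _ hne).unique h
  rw [toRoot, dif_pos hne, hm]

theorem edgeBraid_eq_one {s : Perm (Fin n)} {m : Fin (n - 1)}
    (h : IsGreatest (ascents s n : Set (Fin (n - 1))) m) : edgeBraid s m = 1 := by
  rw [edgeBraid, treeBraid, treeBraid, toRoot_eq_mul h]
  group

theorem edgeBraid_mul_tau_self (s : Perm (Fin n)) (k : Fin (n - 1)) :
    edgeBraid (s * tau k) k = (edgeBraid s k)⁻¹ := by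
  rw [eq_inv_iff_mul_eq_one, edgeBraid, edgeBraid, mul_tau_tau]
  calc _ = treeBraid (s * tau k) * (sigma k * sigma k) * (treeBraid (s * tau k))⁻¹ := by group
    _ = 1 := by rw [sigma_mul_self]; group

/-- Inner tree braids cancel, leaving σ_kσ_l = σ_lσ_k between the tree braids of opposite corners.
-/
theorem edgeBraid_square {k l : Fin (n - 1)} (h : k.val + 1 < l.val) (s : Perm (Fin n)) :
    edgeBraid s k * edgeBraid (s * tau k) l = edgeBraid s l * edgeBraid (s * tau l) k := by
  simp only [edgeBraid, mul_tau_comm s h]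
  calc _ = treeBraid s * (sigma k * sigma l) * (treeBraid (s * tau l * tau k))⁻¹ := by group
    _ = _ := by rw [sigma_comm h]; group

/-- Both m-edges of the square on k and m belong to the tree, so its k-edges agree. -/
theorem edgeBraid_mul_tau {s : Perm (Fin n)} {k m : Fin (n - 1)} (h : k.val + 1 < m.val)
    (hm : IsGreatest (ascents s n : Set (Fin (n - 1))) m) :
    edgeBraid (s * tau m) k = edgeBraid s k := by
  have hm' : IsGreatest (ascents (s * tau k) n : Set (Fin (n - 1))) m :=
    isGreatest_ascents_congr (fun i hi' => by rw [Perm.mul_apply, tau_of_gt (by omega)]) hm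
  have := edgeBraid_square h s
  rwa [edgeBraid_eq_one hm, edgeBraid_eq_one hm', mul_one, one_mul, eq_comm] at this

/-- Sorting the strands to the right of k+1 moves along tree edges and does not change the braid; it
ends at the decreasing generator. -/
theorem edgeBraid_of_descents {s : Perm (Fin n)} {k : Fin (n - 1)} (h : ascents s k.val = ∅)
    (hk : s (hi k) < s (lo k)) : edgeBraid s k = (crossingType s k).braid := by
  by_cases h3 : ∃ m, IsGreatest (ascents s n : Set (Fin (n - 1))) m ∧ k.val + 2 ≤ m.val
  · obtain ⟨m, hm, hkm⟩ := h3
    have hmem := mem_ascents.1 (Finset.mem_coe.1 hm.1)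
    have e : ∀ i : Fin n, i.val ≤ k.val + 1 → (s * tau m) i = s i := fun i hi' => by
      rw [Perm.mul_apply, tau_of_lt (by omega)]
    rw [← edgeBraid_mul_tau hkm hm, ← crossingType_congr e]
    exact edgeBraid_of_descents
      (by rw [ascents_congr fun i hi' => e i (by omega), h])
      (by rwa [e _ (by simp), e _ (by simp)])
  · have hs : BlocksDecrease s k.val n := by
      refine ⟨fun m hm => not_ascent.1 fun ha => ?_, fun m hm => by rwa [Fin.ext hm],
        fun m hkm hml => not_ascent.1 fun ha => h3 ?_⟩
      · have : m ∈ ascents s k.val := mem_ascents.2 ⟨hm, ha⟩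
        simp [h] at this
      · have hmem : m ∈ ascents s n := mem_ascents.2 ⟨hml, ha⟩
        obtain ⟨q, hq⟩ := exists_isGreatest_ascents ⟨m, hmem⟩
        exact ⟨q, hq, hkm.trans (hq.2 hmem)⟩
    rw [CrossingType.braid, decreasingArrangement_crossingType hs, index_crossingType]
termination_by disorder s
decreasing_by exact disorder_mul_tau_lt hmem.2

/-- The rewriting algorithm expresses the pure braid of an edge by those of crossing types. -/
theorem edgeBraid_eq_edgeVal (s : Perm (Fin n)) (k : Fin (n - 1)) :
    edgeBraid s k = edgeVal CrossingType.braid s k := by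
  rcases (ascents s k.val).eq_empty_or_nonempty with h | h
  · by_cases hk : s (hi k) < s (lo k)
    · rw [edgeBraid_of_descents h hk, edgeVal_of_descents _ h hk]
    · have e : ascents (s * tau k) k.val = ∅ := by
        rw [ascents_congr (s' := s) fun i hi' => by rw [Perm.mul_apply, tau_of_lt hi'], h]
      have hk' : (s * tau k) (hi k) < (s * tau k) (lo k) := by
        have := s.injective.ne (lo_ne_hi k)
        rw [Perm.mul_apply, Perm.mul_apply, tau_lo, tau_hi]
        omega
      rw [← inv_inj, ← edgeBraid_mul_tau_self, ← edgeVal_mul_tau_self, edgeBraid_of_descents e hk',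
        edgeVal_of_descents _ e hk']
  · obtain ⟨m, hm⟩ := exists_isGreatest_ascents h
    have hmem := mem_ascents.1 (Finset.mem_coe.1 hm.1)
    -- This square is the recursion step of the algorithm: it conjugates the braid of [sτ_m,k] by
    -- that of [s,m].
    have hsq := edgeBraid_square hmem.1 s
    rw [edgeBraid_eq_edgeVal s m, edgeBraid_eq_edgeVal (s * tau k) m,
      edgeBraid_eq_edgeVal (s * tau m) k, edgeVal_mul_tau _ hmem.1] at hsq
    rw [eq_mul_inv_of_mul_eq hsq.symm, edgeVal.eq_1 _ s k, conjVal_eq_mul _ hm,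
      edgeVal.eq_1 _ (s * tau m) k, letterVal_mul_tau _ hmem.1]
    group
termination_by (k.val, disorder s)
decreasing_by
  · exact Prod.Lex.right _ (disorder_mul_tau_lt hmem.2)
  · exact Prod.Lex.left _ _ (by omega)
  · exact Prod.Lex.left _ _ (by omega)

/-- No strand to the right exceeds the greater strand of the crossing, so after the exchange the
crossing is the last ascent: the reversed edge lies in the tree. -/
theorem CrossingType.braid_eq_one {I : CrossingType n} (h : ¬ I.Essential) : I.braid = 1 := by
  have hs := blocksDecrease_decreasingArrangement I
  rw [← crossingType_decreasingArrangement I, essential_crossingType_iff] at h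
  have hk := hs.middle I.index rfl
  rw [CrossingType.braid, ← inv_inj, ← edgeBraid_mul_tau_self, inv_one]
  refine edgeBraid_eq_one (isGreatest_ascents_mul_tau (by omega) hs fun i hi' _ => ?_)
  by_contra hlt
  have hne : decreasingArrangement I.block i ≠ decreasingArrangement I.block (lo I.index) :=
    (decreasingArrangement I.block).injective.ne (by simp [Fin.ext_iff]; omega)
  exact h ⟨i, hi', by omega, by omega⟩

/-! ### Words in the essential crossing types -/

section Essential

variable {H : Type*} [Group H]

/-- The extension by `1` of a function on the essential crossing types. -/
def extendByOne (f : EssentialCrossingType n → H) (I : CrossingType n) : H :=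
  if h : I.Essential then f ⟨I, h⟩ else 1

theorem extendByOne_of_essential (f : EssentialCrossingType n → H) (I : EssentialCrossingType n) :
    extendByOne f I.1 = f I := dif_pos I.2

theorem extendByOne_of_not_essential (f : EssentialCrossingType n → H) {I : CrossingType n}
    (h : ¬ I.Essential) : extendByOne f I = 1 := dif_neg h

theorem lift_essentialPart (f : EssentialCrossingType n → H) (w : Word n) :
    FreeGroup.lift f (FreeGroup.mk (essentialPart w)) =
      FreeGroup.lift (extendByOne f) (FreeGroup.mk w) := by
  rw [FreeGroup.lift_mk, FreeGroup.lift_mk]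
  induction w with
  | nil => rfl
  | cons a w ih =>
    simp only [essentialPart] at ih ⊢
    by_cases h : a.1.Essential
    · simp only [List.filterMap_cons, h, dif_pos, ih, List.map_cons, List.prod_cons, extendByOne]
    · simp only [List.filterMap_cons, h, dif_neg, not_false_eq_true, ih, List.map_cons,
        List.prod_cons, extendByOne_of_not_essential f h]
      cases a.2 <;> simp

theorem lift_uWord (f : EssentialCrossingType n → H) (J : DoubleCrossingType n) :
    FreeGroup.lift f (FreeGroup.mk (uWord J)) =
      (conjVal (extendByOne f) (decreasingArrangement J.block) J.rightIndex)⁻¹ := by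
  rw [uWord, lift_essentialPart, ← FreeGroup.inv_mk, map_inv, conjVal]

theorem lift_vWord (f : EssentialCrossingType n → H) (J : DoubleCrossingType n) :
    FreeGroup.lift f (FreeGroup.mk (vWord J)) =
      (conjVal (extendByOne f) (decreasingArrangement J.block * tau J.leftIndex)
        J.rightIndex)⁻¹ := by
  rw [vWord, lift_essentialPart, ← FreeGroup.inv_mk, map_inv, conjVal]

/-- In the decreasing triple the left edge has an empty conjugating word, so its label is the letter
J_{[1]} itself and r_J is exactly the square condition. -/
theorem lift_relator_eq_one_iff (f : EssentialCrossingType n → H)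
    (J : EssentialDoubleCrossingType n) :
    FreeGroup.lift f (relator J) = 1 ↔
      Commute (squareVal (extendByOne f) (decreasingArrangement J.1.block) J.1.leftIndex
        J.1.rightIndex) (f J.second) := by
  rw [relator, map_commutatorElement, commutatorElement_eq_one_iff_commute, map_mul, map_mul,
    map_inv, lift_uWord, lift_vWord, inv_inv, FreeGroup.lift_apply_of, FreeGroup.lift_apply_of,
    squareVal, edgeVal_of_descents _ J.1.blocksDecrease.ascents_eq_empty
      (J.1.blocksDecrease.middle _ rfl), J.1.crossingType_left]
  rw [← extendByOne_of_essential f J.first]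
  rfl

theorem extendByOne_braid :
    extendByOne (fun I : EssentialCrossingType n => I.1.braid) = CrossingType.braid := by
  ext1 I
  by_cases h : I.Essential
  · exact dif_pos h
  · rw [extendByOne_of_not_essential _ h, CrossingType.braid_eq_one h]

end Essential

/-- The group presented by the essential crossing types and the relators `r_J`. -/
abbrev CrossingGroup (n : ℕ) : Type := PresentedGroup (Set.range (relator (n := n)))

/-- The square of braids at the decreasing triple, translated by the rewriting algorithm. -/
theorem lift_relator_braid (J : EssentialDoubleCrossingType n) :
    FreeGroup.lift (fun I : EssentialCrossingType n => I.1.braid) (relator J) = 1 := by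
  rw [lift_relator_eq_one_iff, extendByOne_braid]
  have h := (square_iff CrossingType.braid J.1.leftIndex_lt (decreasingArrangement J.1.block)).1 (by
    have := edgeBraid_square J.1.leftIndex_lt (decreasingArrangement J.1.block)
    simp only [edgeBraid_eq_edgeVal] at this
    rwa [edgeVal_mul_tau _ J.1.leftIndex_lt] at this)
  rwa [J.1.crossingType_right] at h

/-- The homomorphism that sends an essential crossing type to its planar pure braid. -/
noncomputable def toBraid (n : ℕ) : CrossingGroup n →* PlanarBraidGroup n :=
  PresentedGroup.toGroup (f := fun I : EssentialCrossingType n => I.1.braid)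
    (by rintro _ ⟨J, rfl⟩; exact lift_relator_braid J)

theorem toBraid_of (I : EssentialCrossingType n) : toBraid n (PresentedGroup.of I) = I.1.braid :=
  PresentedGroup.toGroup.of _

/-- The element of the presented group that a crossing type represents. -/
def letterClass (I : CrossingType n) : CrossingGroup n :=
  extendByOne (fun I => PresentedGroup.of I) I

/-- Only decreasing squares need checking: a non-essential right crossing has trivial letter, an
essential double type supplies its relator, and otherwise the `squareVal` is trivial. -/
theorem squareVal_letterClass (s : Perm (Fin n)) (k l : Fin (n - 1)) (h : k.val + 1 < l.val) :
    Commute (squareVal letterClass s k l) (letterClass (crossingType s l)) := by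
  refine squareVal_commute letterClass (fun s k l h hs => ?_) s k l h
  by_cases h2 : (crossingType s l).Essential
  swap
  · rw [letterClass, extendByOne_of_not_essential _ h2]
    exact Commute.one_right _
  by_cases h1 : ∃ i : Fin n, k.val + 2 ≤ i.val ∧ i.val < l.val ∧ s (lo k) < s i ∧ s (hi k) < s i
  · let J : EssentialDoubleCrossingType n :=
      ⟨doubleCrossingType s k l h, essential_doubleCrossingType_iff.2 ⟨h1, h2⟩⟩
    have hrel : FreeGroup.lift (fun I => (PresentedGroup.of I : CrossingGroup n)) (relator J) = 1 := by
      have e : FreeGroup.lift (fun I => (PresentedGroup.of I : CrossingGroup n)) =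
          PresentedGroup.mk _ := by ext; simp [PresentedGroup.of]
      rw [e]
      exact PresentedGroup.one_of_mem ⟨J, rfl⟩
    rw [lift_relator_eq_one_iff] at hrel
    have hJl : J.1.leftIndex = k := leftIndex_doubleCrossingType s k l h
    have hJr : J.1.rightIndex = l := rightIndex_doubleCrossingType s k l h
    have e : ∀ i : Fin n, i.val < l.val → decreasingArrangement J.1.block i = s i := fun i hi' =>
      decreasingArrangement_doubleCrossingType h hs hi'
    rw [hJl, hJr, ← extendByOne_of_essential (fun I => (PresentedGroup.of I : CrossingGroup n))] at hrel
    have hsecond : J.second.1 = crossingType s l := second_doubleCrossingType s k l h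
    rw [hsecond, squareVal, conjVal_congr _ e,
      edgeVal_congr (s' := s) _ fun i hi' => e i (by omega),
      conjVal_congr (s := _ * tau k) (s' := s * tau k) _ fun i hi' => by
        rw [Perm.mul_apply, Perm.mul_apply, e _ (by rw [tau_val]; split_ifs <;> omega)]] at hrel
    exact hrel
  -- No middle strand exceeds both crossing strands, so the algorithm at sτ_k first undoes the
  -- exchange at k and then proceeds as at s; this cancels the edge at k.
  · have hg : IsGreatest (ascents (s * tau k) l.val : Set (Fin (n - 1))) k := by
      refine isGreatest_ascents_mul_tau h hs fun i hi' hil => ?_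
      by_contra hlt
      have hne : s i ≠ s (lo k) := s.injective.ne (by simp [Fin.ext_iff]; omega)
      have := hs.middle k rfl
      exact h1 ⟨i, hi', hil, by omega, by omega⟩
    have e : squareVal letterClass s k l = 1 := by
      rw [squareVal, conjVal_eq_mul _ hg, edgeVal_mul_tau_self, mul_tau_tau]
      group
    rw [e]
    exact Commute.one_left _

theorem edgeVal_letterClass_square {k l : Fin (n - 1)} (h : k.val + 1 < l.val) (s : Perm (Fin n)) :
    edgeVal letterClass s k * edgeVal letterClass (s * tau k) l =
      edgeVal letterClass s l * edgeVal letterClass (s * tau l) k := by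
  rw [(square_iff _ h s).2 (squareVal_letterClass s k l h), edgeVal_mul_tau _ h]

theorem edgeVal_letterClass_eq_one {s : Perm (Fin n)} {m : Fin (n - 1)}
    (h : IsGreatest (ascents s n : Set (Fin (n - 1))) m) : edgeVal letterClass s m = 1 := by
  have : letterClass (crossingType s m) = 1 :=
    extendByOne_of_not_essential _ (not_essential_of_isGreatest h)
  simp [edgeVal, letterVal, this]

theorem edgeVal_letterClass_decreasingArrangement (I : EssentialCrossingType n) :
    edgeVal letterClass (decreasingArrangement I.1.block) I.1.index = PresentedGroup.of I := by
  have hs := blocksDecrease_decreasingArrangement I.1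
  rw [edgeVal_of_descents _ hs.ascents_eq_empty (hs.middle _ rfl),
    crossingType_decreasingArrangement]
  exact extendByOne_of_essential _ I

theorem toBraid_edgeVal (s : Perm (Fin n)) (k : Fin (n - 1)) :
    toBraid n (edgeVal letterClass s k) = edgeBraid s k := by
  have e : ∀ I : CrossingType n, toBraid n (letterClass I) = I.braid := fun I => by
    by_cases h : I.Essential
    · have : letterClass I = PresentedGroup.of ⟨I, h⟩ := dif_pos h
      rw [this, toBraid_of]
    · have : letterClass I = 1 := dif_neg h
      rw [this, map_one, CrossingType.braid_eq_one h]
  have e' : (toBraid n).comp (FreeGroup.lift letterClass) = FreeGroup.lift CrossingType.braid := by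
    ext I; simp [e]
  rw [edgeBraid_eq_edgeVal, ← lift_wordOf, ← lift_wordOf, ← e', MonoidHom.comp_apply]

/-! ### The action of the planar braid group -/

/-- The permutation of the pairs of an element of the presented group and an arrangement by which a
generator of the planar braid group acts. -/
noncomputable def generatorAction (k : Fin (n - 1)) : Perm (CrossingGroup n × Perm (Fin n)) :=
  Function.Involutive.toPerm
    (fun p => (edgeVal letterClass (p.2 * tau k) k * p.1, p.2 * tau k)) fun p => by
      simp [edgeVal_mul_tau_self]

theorem generatorAction_apply (k : Fin (n - 1)) (p : CrossingGroup n × Perm (Fin n)) :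
    generatorAction k p = (edgeVal letterClass (p.2 * tau k) k * p.1, p.2 * tau k) := rfl

/-- The relation σ_i² = 1 holds because reversed edges have inverse labels, the commutation
relations because the labelled squares close. -/
theorem generatorAction_rels : ∀ r ∈ braidRels n, FreeGroup.lift (generatorAction (n := n)) r = 1 := by
  rintro r (⟨i, rfl⟩ | ⟨i, j, hij, rfl⟩)
  · ext1 p
    simp [pow_two, generatorAction_apply, edgeVal_mul_tau_self]
  · rw [map_commutatorElement, FreeGroup.lift_apply_of, FreeGroup.lift_apply_of,
      commutatorElement_eq_one_iff_mul_comm]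
    ext1 p
    -- The action runs along edges backwards, so the square is based at the arrangement where the
    -- motion ends.
    have := edgeVal_letterClass_square hij (p.2 * tau i * tau j)
    rw [mul_tau_tau, mul_tau_comm p.2 hij, mul_tau_tau] at this
    simp only [Perm.mul_apply, generatorAction_apply, ← mul_assoc, mul_tau_comm p.2 hij, this]

/-- The action of the planar braid group on the pairs of an element of the presented group and an
arrangement. -/
noncomputable def action (n : ℕ) :
    PlanarBraidGroup n →* Perm (CrossingGroup n × Perm (Fin n)) :=
  PresentedGroup.toGroup generatorAction_rels

theorem action_sigma (k : Fin (n - 1)) (x : CrossingGroup n) (s : Perm (Fin n)) :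
    action n (sigma k) (x, s * tau k) = (edgeVal letterClass s k * x, s) := by
  have : action n (sigma k) = generatorAction k := PresentedGroup.toGroup.of _
  rw [this, generatorAction_apply, mul_tau_tau]

/-- The decreasing arrangement of all strands. -/
def rootArrangement (n : ℕ) : Perm (Fin n) := decreasingArrangement fun _ => (0 : Fin 1)

theorem eq_rootArrangement {s : Perm (Fin n)} (h : ascents s n = ∅) : s = rootArrangement n := by
  ext1 i
  refine (decreasingArrangement_apply (L := n) (fun i j hij _ => Or.inr ⟨rfl, ?_⟩) i.isLt).symm
  refine lt_of_forall_descent (a := 0) (b := n) (fun m _ hm ha => ?_) (Nat.zero_le _) hij j.isLt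
  have : m ∈ ascents s n := mem_ascents.2 ⟨hm, ha⟩
  simp [h] at this

theorem action_toRoot (s : Perm (Fin n)) (x : CrossingGroup n) :
    action n (toRoot s) (x, rootArrangement n) = (x, s) := by
  rcases (ascents s n).eq_empty_or_nonempty with h | h
  · rw [toRoot_eq_one h, map_one, Perm.one_apply, eq_rootArrangement h]
  · obtain ⟨m, hm⟩ := exists_isGreatest_ascents h
    have hmem := mem_ascents.1 (Finset.mem_coe.1 hm.1)
    rw [toRoot_eq_mul hm, map_mul, Perm.mul_apply, action_toRoot (s * tau m), action_sigma,
      edgeVal_letterClass_eq_one hm, one_mul]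
termination_by disorder s
decreasing_by exact disorder_mul_tau_lt hmem.2

theorem action_treeBraid (s : Perm (Fin n)) (x : CrossingGroup n) :
    action n (treeBraid s) (x, s) = (x, 1) := by
  rw [treeBraid, map_mul, map_inv, Perm.mul_apply, ← action_toRoot 1 x]
  congr 1
  rw [Perm.inv_eq_iff_eq, action_toRoot]

theorem action_edgeBraid (s : Perm (Fin n)) (k : Fin (n - 1)) (x : CrossingGroup n) :
    action n (edgeBraid s k) (x, 1) = (edgeVal letterClass s k * x, 1) := by
  have h : (action n (treeBraid (s * tau k)))⁻¹ (x, 1) = (x, s * tau k) := by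
    rw [Perm.inv_eq_iff_eq, action_treeBraid]
  rw [edgeBraid, map_mul, map_mul, map_inv, Perm.mul_apply, Perm.mul_apply, h, action_sigma,
    action_treeBraid]

/-- Tree edges act without changing the group component, so the loop of a decreasing generator
multiplies by the label of that one edge, which is the generator itself. -/
theorem action_toBraid (g x : CrossingGroup n) : action n (toBraid n g) (x, 1) = (g * x, 1) := by
  have key : g ∈ Subgroup.closure (Set.range (PresentedGroup.of (rels := Set.range (relator (n := n))))) := by
    rw [PresentedGroup.closure_range_of]; trivial
  induction key using Subgroup.closure_induction generalizing x with
  | mem g hg =>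
    obtain ⟨I, rfl⟩ := hg
    rw [toBraid_of, CrossingType.braid, action_edgeBraid,
      edgeVal_letterClass_decreasingArrangement]
  | one => simp
  | mul g h _ _ ihg ihh => rw [map_mul, map_mul, Perm.mul_apply, ihh, ihg, mul_assoc]
  | inv g _ ih => rw [map_inv, map_inv, Perm.inv_eq_iff_eq, ih, mul_inv_cancel_left]

theorem toBraid_injective : Function.Injective (toBraid n) := by
  rw [injective_iff_map_eq_one]
  intro g hg
  have := action_toBraid g 1
  rw [hg, map_one, Perm.one_apply, mul_one] at this
  exact (congrArg Prod.fst this).symm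

/-! ### The image -/

theorem mul_toPerm_toRoot (s : Perm (Fin n)) : s * toPerm n (toRoot s) = rootArrangement n := by
  rcases (ascents s n).eq_empty_or_nonempty with h | h
  · rw [toRoot_eq_one h, map_one, mul_one, eq_rootArrangement h]
  · obtain ⟨m, hm⟩ := exists_isGreatest_ascents h
    have hmem := mem_ascents.1 (Finset.mem_coe.1 hm.1)
    rw [toRoot_eq_mul hm, map_mul, toPerm_sigma, ← mul_assoc, mul_toPerm_toRoot (s * tau m)]
termination_by disorder s
decreasing_by exact disorder_mul_tau_lt hmem.2

theorem toPerm_treeBraid (s : Perm (Fin n)) : toPerm n (treeBraid s) = s := by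
  have h1 := mul_toPerm_toRoot (1 : Perm (Fin n))
  rw [one_mul] at h1
  rw [treeBraid, map_mul, map_inv, h1, ← mul_toPerm_toRoot s, mul_inv_cancel_right]

theorem toPerm_edgeBraid (s : Perm (Fin n)) (k : Fin (n - 1)) : toPerm n (edgeBraid s k) = 1 := by
  rw [edgeBraid, map_mul, map_mul, map_inv, toPerm_treeBraid, toPerm_treeBraid, toPerm_sigma,
    mul_inv_cancel]

theorem toBraid_mem (g : CrossingGroup n) : toBraid n g ∈ PlanarPureBraidGroup n := by
  have : (toPerm n).comp (toBraid n) = 1 := PresentedGroup.ext fun I => by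
    rw [MonoidHom.comp_apply, toBraid_of, CrossingType.braid, toPerm_edgeBraid, MonoidHom.one_apply]
  exact DFunLike.congr_fun this g

/-- Schreier telescoping: a product splits into loops through the tree, and a single σ_k gives the
braid of an edge. -/
theorem treeBraid_mul_mem_range (p : PlanarBraidGroup n) (s : Perm (Fin n)) :
    treeBraid s * p * (treeBraid (s * toPerm n p))⁻¹ ∈ (toBraid n).range := by
  have key : p ∈ Subgroup.closure (Set.range (PresentedGroup.of (rels := braidRels n))) := by
    rw [PresentedGroup.closure_range_of]; trivial
  induction key using Subgroup.closure_induction generalizing s with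
  | mem p hp =>
    obtain ⟨k, rfl⟩ := hp
    have : toPerm n (PresentedGroup.of k) = tau k := toPerm_sigma k
    rw [this]
    exact ⟨_, toBraid_edgeVal s k⟩
  | one => simp
  | mul p q _ _ ihp ihq =>
    have := mul_mem (ihp s) (ihq (s * toPerm n p))
    rw [map_mul, ← mul_assoc]
    convert this using 1
    group
  | inv p _ ih =>
    have := inv_mem (ih (s * (toPerm n p)⁻¹))
    rw [inv_mul_cancel_right] at this
    rw [map_inv]
    convert this using 1
    group

theorem mem_range_toBraid {p : PlanarBraidGroup n} (hp : p ∈ PlanarPureBraidGroup n) :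
    p ∈ (toBraid n).range := by
  have h := treeBraid_mul_mem_range p 1
  rw [MonoidHom.mem_ker.1 hp, mul_one] at h
  have h1 : treeBraid (1 : Perm (Fin n)) = 1 := by rw [treeBraid, mul_inv_cancel]
  rwa [h1, one_mul, inv_one, mul_one] at h

/-- The presentation of the planar pure braid group. -/
noncomputable def crossingGroupEquiv (n : ℕ) : CrossingGroup n ≃* PlanarPureBraidGroup n :=
  MulEquiv.ofBijective ((toBraid n).codRestrict _ toBraid_mem)
    ⟨fun g h e => toBraid_injective (congrArg Subtype.val e), fun p => by
      obtain ⟨g, hg⟩ := mem_range_toBraid p.2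
      exact ⟨g, Subtype.ext hg⟩⟩

theorem crossingGroupEquiv_of (I : EssentialCrossingType n) :
    (crossingGroupEquiv n (PresentedGroup.of I) : PlanarBraidGroup n) = I.1.braid :=
  toBraid_of I

/-! ### Letters of the conjugating words -/

/-- Some strand stands before a smaller one of an earlier block of `K`. -/
def Obstructs (K : CrossingType n) (s : Perm (Fin n)) : Prop :=
  ∃ i j : Fin n, i < j ∧ s j < s i ∧ K.block (s j) < K.block (s i)

/-- An adjacent exchange reverses only the order of the exchanged pair; here that pair is an ascent
and not the obstructing inversion. -/
theorem Obstructs.mul_tau {K : CrossingType n} {s : Perm (Fin n)} {m : Fin (n - 1)}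
    (h : Obstructs K s) (hm : s (lo m) < s (hi m)) : Obstructs K (s * tau m) := by
  obtain ⟨i, j, hij, hs, hK⟩ := h
  have e : ∀ i, (s * tau m) (tau m i) = s i := fun i => by
    rw [← Perm.mul_apply, mul_tau_tau]
  refine ⟨tau m i, tau m j, ?_, by rwa [e, e], by rwa [e, e]⟩
  have hne : ¬ (i = lo m ∧ j = hi m) := by
    rintro ⟨rfl, rfl⟩
    exact hs.asymm hm
  rw [Fin.ext_iff, Fin.ext_iff, lo_val, hi_val] at hne
  rw [Fin.lt_def] at hij ⊢
  rw [tau_val, tau_val]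
  split_ifs <;> omega

theorem Obstructs.crossingType_ne {K : CrossingType n} {s : Perm (Fin n)} {k : Fin (n - 1)}
    (h : Obstructs K s) : crossingType s k ≠ K := by
  rintro rfl
  obtain ⟨i, j, hij, -, hK⟩ := h
  revert hK
  rw [Fin.lt_def] at hij
  simp only [crossingType, inv_apply, Fin.lt_def, Fin.le_def, lo_val, hi_val]
  split_ifs <;> simp <;> omega

/-- The crossing types that occur in a word. -/
def letters (w : Word n) : Set (CrossingType n) := {I | ∃ ε, (I, ε) ∈ w}

theorem letters_invRev (w : Word n) : letters (FreeGroup.invRev w) = letters w := by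
  ext I
  simp [letters, FreeGroup.invRev, or_comm]

theorem letters_append (w w' : Word n) : letters (w ++ w') = letters w ∪ letters w' := by
  ext I
  simp [letters, exists_or]

theorem letters_wordOf (w : Word n) (s : Perm (Fin n)) (k : Fin (n - 1)) :
    letters (wordOf w s k) = insert (crossingType s k) (letters w) := by
  rw [wordOf, letters_append, letters_append, letters_invRev]
  ext I
  simp only [letters, List.mem_singleton, Set.mem_union, Set.mem_ofPred_eq, Set.mem_insert_iff,
    Prod.mk.injEq, exists_and_left, exists_eq, and_true]
  tauto

theorem letters_conjWord_nil {s : Perm (Fin n)} {k : Fin (n - 1)} (h : ascents s k.val = ∅) :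
    letters (conjWord s k) = ∅ := by
  simp [conjWord_eq_nil h, letters]

theorem letters_conjWord {s : Perm (Fin n)} {k m : Fin (n - 1)}
    (h : IsGreatest (ascents s k.val : Set (Fin (n - 1))) m) :
    letters (conjWord s k) =
      insert (crossingType s m) (letters (conjWord s m)) ∪ letters (conjWord (s * tau m) k) := by
  rw [conjWord_eq_append h, letters_append, letters_wordOf]

/-- The algorithm exchanges only positions before k, and nested words lie farther left still. -/
theorem index_lt_of_mem_letters {s : Perm (Fin n)} {k : Fin (n - 1)} {I : CrossingType n}
    (h : I ∈ letters (conjWord s k)) : I.index.val + 1 < k.val := by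
  rcases (ascents s k.val).eq_empty_or_nonempty with he | hne
  · simp [letters_conjWord_nil he] at h
  · obtain ⟨m, hm⟩ := exists_isGreatest_ascents hne
    have hmem := mem_ascents.1 (Finset.mem_coe.1 hm.1)
    rw [letters_conjWord hm] at h
    rcases h with (rfl | h) | h
    · rw [index_crossingType]; exact hmem.1
    · have := index_lt_of_mem_letters h
      omega
    · exact index_lt_of_mem_letters h
termination_by (k.val, disorder s)
decreasing_by
  · exact Prod.Lex.left _ _ (by omega)
  · exact Prod.Lex.right _ (disorder_mul_tau_lt hmem.2)

/-- Every letter is read off at an arrangement reached from s by exchanging ascents, where the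
obstruction persists. -/
theorem Obstructs.notMem_letters {K : CrossingType n} {s : Perm (Fin n)} {k : Fin (n - 1)}
    (hs : Obstructs K s) : K ∉ letters (conjWord s k) := by
  rcases (ascents s k.val).eq_empty_or_nonempty with he | hne
  · simp [letters_conjWord_nil he]
  · obtain ⟨m, hm⟩ := exists_isGreatest_ascents hne
    have hmem := mem_ascents.1 (Finset.mem_coe.1 hm.1)
    rw [letters_conjWord hm]
    rintro ((h | h) | h)
    · exact hs.crossingType_ne h.symm
    · exact hs.notMem_letters h
    · exact (hs.mul_tau hmem.2).notMem_letters h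
termination_by (k.val, disorder s)
decreasing_by
  · exact Prod.Lex.left _ _ (by omega)
  · exact Prod.Lex.right _ (disorder_mul_tau_lt hmem.2)

theorem crossingType_notMem_letters {s : Perm (Fin n)} {k l : Fin (n - 1)} (h : k.val + 2 < l.val)
    (hright : ∀ m : Fin (n - 1), k.val + 2 ≤ m.val → m.val + 1 < l.val → s (hi m) < s (lo m))
    {i : Fin n} (hik : i.val = k.val + 2) (hlt : s (hi k) < s i) :
    crossingType s k ∉ letters (conjWord s l) := by
  -- The first exchange joins the right strand of the crossing to the first strand after it. Its
  -- letter has index k+1 and its conjugating word only indices below k.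
  let m : Fin (n - 1) := ⟨k.val + 1, by omega⟩
  have hlo : lo m = hi k := rfl
  have hhi : hi m = i := Fin.ext hik.symm
  have hm : IsGreatest (ascents s l.val : Set (Fin (n - 1))) m := by
    refine ⟨mem_ascents.2 ⟨h, by rwa [hlo, hhi]⟩, fun p hp => ?_⟩
    by_contra hmp
    have hmp : k.val + 1 < p.val := by simpa [m, Fin.lt_def] using hmp
    have hp := mem_ascents.1 (Finset.mem_coe.1 hp)
    exact (hright p hmp hp.1).asymm hp.2
  rw [letters_conjWord hm]
  rintro ((h' | h') | h')
  · have := congrArg CrossingType.index h'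
    rw [index_crossingType, index_crossingType] at this
    simp [m, Fin.ext_iff] at this
  · have := index_lt_of_mem_letters h'
    rw [index_crossingType] at this
    simp [m] at this
  -- After the exchange a strand of the third block stands before a smaller strand of the second.
  · refine Obstructs.notMem_letters ⟨hi k, i, ?_, ?_, ?_⟩ h'
    · rw [Fin.lt_def, hi_val]; omega
    · rw [← hlo, ← hhi, Perm.mul_apply, Perm.mul_apply, tau_lo, tau_hi, hlo, hhi]; exact hlt
    · rw [← hlo, ← hhi, Perm.mul_apply, Perm.mul_apply, tau_lo, tau_hi, hlo, hhi]
      simp only [crossingType, inv_apply, Fin.lt_def, Fin.le_def, lo_val, hi_val, hik]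
      split_ifs <;> simp <;> omega

theorem mem_letters_of_mem_essentialPart {w : Word n} {I : EssentialCrossingType n} {ε : Bool}
    (h : (I, ε) ∈ essentialPart (FreeGroup.invRev w)) : I.1 ∈ letters w := by
  rw [← letters_invRev]
  simp only [essentialPart, List.mem_filterMap] at h
  obtain ⟨a, ha, e⟩ := h
  split_ifs at e with hess
  simp only [Option.some.injEq, Prod.mk.injEq] at e
  exact ⟨a.2, by rw [← e.1]; exact ha⟩

theorem EssentialDoubleCrossingType.notMem_letters (J : EssentialDoubleCrossingType n) :
    (J.1.first ∉ letters (conjWord (decreasingArrangement J.1.block) J.1.rightIndex) ∧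
      J.1.second ∉ letters (conjWord (decreasingArrangement J.1.block) J.1.rightIndex)) ∧
    J.1.first ∉ letters
      (conjWord (decreasingArrangement J.1.block * tau J.1.leftIndex) J.1.rightIndex) ∧
      J.1.second ∉ letters
        (conjWord (decreasingArrangement J.1.block * tau J.1.leftIndex) J.1.rightIndex) := by
  have hlt := J.1.leftIndex_lt
  have hs := J.1.blocksDecrease
  have hl := J.1.crossingType_left
  have hr := J.1.crossingType_right
  have hsecond : ∀ s : Perm (Fin n), J.1.second ∉ letters (conjWord s J.1.rightIndex) := by
    intro s h
    have := index_lt_of_mem_letters h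
    rw [← hr, index_crossingType] at this
    omega
  obtain ⟨⟨x, hx, hxy⟩, -⟩ := J.2
  have hb2 := block_decreasingArrangement_lt_iff J.1.block 2
  have hb3 := block_decreasingArrangement_lt_iff J.1.block 3
  have hb1 := block_decreasingArrangement_lt_iff J.1.block 1
  rw [J.1.card_lt_one] at hb1
  rw [J.1.card_lt_two] at hb2
  rw [J.1.card_lt_three] at hb3
  obtain ⟨j, rfl⟩ := (decreasingArrangement J.1.block).surjective x
  have h2 := hb2 j
  have h3 := hb3 j
  have hj : J.1.leftIndex.val + 2 ≤ j.val ∧ j.val < J.1.rightIndex.val := by omega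
  -- The first position of J_3; it carries the greatest strand of that block, hence one above both
  -- strands of J_2.
  let i : Fin n := ⟨J.1.leftIndex.val + 2, by omega⟩
  have hij : decreasingArrangement J.1.block j ≤ decreasingArrangement J.1.block i := by
    rcases (show i ≤ j from hj.1).eq_or_lt with e | hlt'
    · rw [e]
    · exact (hs.lt hlt' (Or.inr (Or.inr ⟨le_rfl, hj.2⟩))).le
  have hlo : decreasingArrangement J.1.block (lo J.1.leftIndex) < decreasingArrangement J.1.block i := by
    refine lt_of_lt_of_le (hxy _ ?_) hij
    have h1' := hb1 (lo J.1.leftIndex)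
    have h2' := hb2 (lo J.1.leftIndex)
    rw [lo_val] at h1' h2'
    omega
  have hhi := (hs.middle _ rfl).trans hlo
  refine ⟨⟨?_, hsecond _⟩, ?_, hsecond _⟩
  · rw [← hl]
    exact crossingType_notMem_letters (by omega) hs.right (i := i) rfl hhi
  -- Exchanging the strands of J_2 keeps the crossing type, and the new right strand is still
  -- smaller than the one at i.
  · rw [← hl, ← crossingType_mul_tau _ (Or.inr (Or.inl rfl))]
    refine crossingType_notMem_letters (by omega) (fun m hm hml => ?_) (i := i) rfl ?_
    · rw [Perm.mul_apply, Perm.mul_apply, tau_of_gt (i := hi m) (by rw [hi_val]; omega),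
        tau_of_gt (i := lo m) (by rw [lo_val]; omega)]
      exact hs.right m hm hml
    · rw [Perm.mul_apply, Perm.mul_apply, tau_hi, tau_of_gt (i := i) (by simp [i])]
      exact hlo

end PlanarBraid

open PlanarBraid in
theorem mainTheorem1 (n : ℕ) :
    (∀ (J : EssentialDoubleCrossingType n) (ε : Bool),
      (J.first, ε) ∉ uWord J.1 ∧ (J.second, ε) ∉ uWord J.1 ∧
        (J.first, ε) ∉ vWord J.1 ∧ (J.second, ε) ∉ vWord J.1) ∧
    ∃ φ : PresentedGroup (Set.range (relator (n := n))) ≃* PlanarPureBraidGroup n,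
      ∀ I : EssentialCrossingType n,
        (φ (PresentedGroup.of I) : PlanarBraidGroup n) = I.1.braid := by
  refine ⟨fun J ε => ?_, crossingGroupEquiv n, crossingGroupEquiv_of⟩
  obtain ⟨⟨h1, h2⟩, h3, h4⟩ := J.notMem_letters
  exact ⟨fun h => h1 (mem_letters_of_mem_essentialPart h),
    fun h => h2 (mem_letters_of_mem_essentialPart h),
    fun h => h3 (mem_letters_of_mem_essentialPart h),
    fun h => h4 (mem_letters_of_mem_essentialPart h)⟩
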